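/- Work in second-order arithmetic, with $\mathbb{N}$ denoting the first-order part of a possibly nonstandard structure. $\mathsf{RCA}_0$ consists of the basic axioms for $0,1,+,\cdot,<$, the $\Sigma^0_1$ induction scheme and the $\Delta^0_1$ comprehension scheme (with number and set parameters). A set $X\subseteq\mathbb{N}$ is infinite if it is unbounded. Sequences of sets, relations and functions are coded by sets of (coded) pairs. $\mathsf{CAC}$ is the statement: for every infinite partial order $(P,\le_P)$ there is an infinite $Y\subseteq P$ which is a chain (any $x,y\in Y$ satisfy $x\le_P y$ or $y\le_P x$) or an antichain (any distinct $x,y\in Y$ satisfy $x\nleq_P y$ and $y\nleq_P x$). A countable second-countable (CSC) space is a triple $\langle X,\mathcal{U},k\rangle$ where $X\subseteq\mathbb{N}$; $\mathcal{U}=\langle U_n:n\in\mathbb{N}\rangle$ is a sequence of subsets of $X$ (the basic open sets) such that every $x\in X$ lies in some $U_n$; and $k:X\times\mathbb{N}\times\mathbb{N}\to\mathbb{N}$ is such that $x\in U_{k(x,m,n)}\subseteq U_m\cap U_n$ whenever $x\in U_m\cap U_n$. It is infinite if $X$ is. A subspace is given by a set $Y\subseteq X$, with basic open sets $U_n\cap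 Y$. The closure relation of the space is the set $\operatorname{cl}\subseteq X^2$ (if it exists) such that $\langle y,x\rangle\in\operatorname{cl}$ if and only if every $U_n$ containing $y$ contains $x$. Let $Y$ be an infinite space with basic open sets $W_n$ $(n\in\mathbb{N})$. - $Y$ is $T_1$ if for all $x\ne y$ in $Y$ there are $m,n$ with $x\in W_m\setminus W_n$ and $y\in W_n\setminus W_m$. - $Y$ is indiscrete if every $W_n$ is $\emptyset$ or $Y$. - $Y$ has the initial segment topology if there is a bijection $h:\mathbb{N}\to Y$ such that every $W_n$ is $\emptyset$, $Y$, or $\{h(i):i\le j\}$ for some $j$, and every set $\{h(i):i\le j\}$, $j\in\mathbb{N}$, is some $W_n$. - $Y$ has the final segment topology if the same holds with $\{h(i):i\ge j\}$ in place of $\{h(i):i\le j\}$. $\mathsf{wGS}^{\operatorname{cl}}$ is the statement: every infinite CSC space whose closure relation exists has an infinite subspace which is indiscrete, has the initial segment topology, has the final segment topology, or is $T_1$. Theorem. $\mathsf{CAC}$ and $\mathsf{wGS}^{\operatorname{cl}}$ are equivalent over $\mathsf{RCA}_0$: in every model of $\mathsf{RCA}_0$ (with arbitrary first-order part and arbitrary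 family of sets), $\mathsf{CAC}$ holds if and only if $\mathsf{wGS}^{\operatorname{cl}}$ holds. -/

import Mathlib

universe u

/-! ### Second-order arithmetic: structures, bounded-quantifier formulas, `RCA₀` -/

/-- A structure for the two-sorted language of second-order arithmetic with non-logical symbols
`0, 1, +, ·, <, ∈`. Number variables range over `M`; set variables range over the family `sets`
of subsets of `M`, which need not be the full power set. Equality of numbers is true equality. -/
structure L2Structure where
  M : Type u
  zero : M
  one : M
  add : M → M → M
  mul : M → M → M
  lt : M → M → Prop
  sets : Set (Set M)

/-- Numerical terms. Number variables are de Bruijn indices. -/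
inductive L2Term : Type
  | var (i : ℕ) : L2Term
  | zero : L2Term
  | one : L2Term
  | add (s t : L2Term) : L2Term
  | mul (s t : L2Term) : L2Term

/-- `Δ⁰₀` formulas: formulas without set quantifiers, all of whose number quantifiers are
bounded. `mem t i` is `t ∈ Xᵢ`, where `Xᵢ` is the `i`-th (free) set variable. The quantifiers
`∀ x < t` and `∃ x < t` bind the number variable with index `0` of their body; the term `t` is
read outside their scope, so that it cannot contain the bound variable. -/
inductive Delta0Formula : Type
  | eq (s t : L2Term) : Delta0Formula
  | lt (s t : L2Term) : Delta0Formula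
  | mem (t : L2Term) (i : ℕ) : Delta0Formula
  | not (φ : Delta0Formula) : Delta0Formula
  | and (φ ψ : Delta0Formula) : Delta0Formula
  | or (φ ψ : Delta0Formula) : Delta0Formula
  | allLt (t : L2Term) (φ : Delta0Formula) : Delta0Formula
  | exLt (t : L2Term) (φ : Delta0Formula) : Delta0Formula

/-- The assignment that gives the variable `0` the value `x` and the variable `i + 1` the value
`v i`. -/
def consAssignment {M : Type u} (x : M) (v : ℕ → M) : ℕ → M
  | 0 => x
  | i + 1 => v i

/-- The value of a term in the structure `N` under the assignment `v`. -/
def L2Term.eval (N : L2Structure.{u}) (v : ℕ → N.M) : L2Term → N.M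
  | .var i => v i
  | .zero => N.zero
  | .one => N.one
  | .add s t => N.add (s.eval N v) (t.eval N v)
  | .mul s t => N.mul (s.eval N v) (t.eval N v)

/-- Truth of a `Δ⁰₀` formula in the structure `N`, where `v` assigns values to the number
variables and `V` to the set variables. -/
def Delta0Formula.Realize (N : L2Structure.{u}) (V : ℕ → Set N.M) :
    Delta0Formula → (ℕ → N.M) → Prop
  | .eq s t, v => s.eval N v = t.eval N v
  | .lt s t, v => N.lt (s.eval N v) (t.eval N v)
  | .mem t i, v => t.eval N v ∈ V i
  | .not φ, v => ¬ φ.Realize N V v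
  | .and φ ψ, v => φ.Realize N V v ∧ ψ.Realize N V v
  | .or φ ψ, v => φ.Realize N V v ∨ ψ.Realize N V v
  | .allLt t φ, v => ∀ x, N.lt x (t.eval N v) → φ.Realize N V (consAssignment x v)
  | .exLt t φ, v => ∃ x, N.lt x (t.eval N v) ∧ φ.Realize N V (consAssignment x v)

namespace L2Structure

/-- The first-order basic axioms of second-order arithmetic. -/
structure BasicAxioms (N : L2Structure.{u}) : Prop where
  succ_ne_zero : ∀ n, N.add n N.one ≠ N.zero
  succ_inj : ∀ m n, N.add m N.one = N.add n N.one → m = n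
  add_zero : ∀ m, N.add m N.zero = m
  add_succ : ∀ m n, N.add m (N.add n N.one) = N.add (N.add m n) N.one
  mul_zero : ∀ m, N.mul m N.zero = N.zero
  mul_succ : ∀ m n, N.mul m (N.add n N.one) = N.add (N.mul m n) m
  not_lt_zero : ∀ m, ¬ N.lt m N.zero
  lt_succ_iff : ∀ m n, N.lt m (N.add n N.one) ↔ N.lt m n ∨ m = n

/-- The formula `(∃ y) θ(y, n, v)` for a `Δ⁰₀` formula `θ` with number parameters `v` and set
parameters `V`, as a property of `n`: a `Σ⁰₁` formula. -/
def Sigma1 (N : L2Structure.{u}) (θ : Delta0Formula) (V : ℕ → Set N.M) (v : ℕ → N.M)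
    (n : N.M) : Prop :=
  ∃ y, θ.Realize N V (consAssignment y (consAssignment n v))

/-- The formula `(∀ y) θ(y, n, v)` for a `Δ⁰₀` formula `θ` with number parameters `v` and set
parameters `V`, as a property of `n`: a `Π⁰₁` formula. -/
def Pi1 (N : L2Structure.{u}) (θ : Delta0Formula) (V : ℕ → Set N.M) (v : ℕ → N.M)
    (n : N.M) : Prop :=
  ∀ y, θ.Realize N V (consAssignment y (consAssignment n v))

/-- The `Σ⁰₁` induction scheme, with number and set parameters from the structure. -/
def Sigma1Induction (N : L2Structure.{u}) : Prop :=
  ∀ (θ : Delta0Formula) (V : ℕ → Set N.M) (v : ℕ → N.M), (∀ i, V i ∈ N.sets) →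
    N.Sigma1 θ V v N.zero →
    (∀ n, N.Sigma1 θ V v n → N.Sigma1 θ V v (N.add n N.one)) →
    ∀ n, N.Sigma1 θ V v n

/-- The `Δ⁰₁` comprehension scheme, with number and set parameters from the structure. -/
def Delta1Comprehension (N : L2Structure.{u}) : Prop :=
  ∀ (θ ψ : Delta0Formula) (V : ℕ → Set N.M) (v : ℕ → N.M), (∀ i, V i ∈ N.sets) →
    (∀ n, N.Sigma1 θ V v n ↔ N.Pi1 ψ V v n) →
    ∃ X ∈ N.sets, ∀ n, n ∈ X ↔ N.Sigma1 θ V v n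

/-- `N` is a model of `RCA₀`. As the family of sets is one of the two sorts of the structure, it
is non-empty. -/
structure IsModelRCA0 (N : L2Structure.{u}) : Prop where
  sets_nonempty : N.sets.Nonempty
  basic : N.BasicAxioms
  sigma1Induction : N.Sigma1Induction
  delta1Comprehension : N.Delta1Comprehension

/-! ### Coding in second-order arithmetic

Below, every quantifier over numbers ranges over `N.M`, and every set that is said to exist is an
element of `N.sets`. -/

/-- `i ≤ j`. -/
def le (N : L2Structure.{u}) (i j : N.M) : Prop := N.lt i j ∨ i = j

/-- The code `(a + b)² + a` of the ordered pair `⟨a, b⟩`. -/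
def pair (N : L2Structure.{u}) (a b : N.M) : N.M :=
  N.add (N.mul (N.add a b) (N.add a b)) a

/-- The product `A × B`, as a set of codes of pairs. -/
def prod (N : L2Structure.{u}) (A B : Set N.M) : Set N.M :=
  {z | ∃ a ∈ A, ∃ b ∈ B, z = N.pair a b}

/-- `X` is infinite, that is, unbounded. -/
def Infinite (N : L2Structure.{u}) (X : Set N.M) : Prop :=
  ∀ b, ∃ x ∈ X, N.lt b x

/-- `F` is (the graph of) a function from `A` to `B`. -/
def IsFunction (N : L2Structure.{u}) (F A B : Set N.M) : Prop :=
  F ⊆ N.prod A B ∧ ∀ a ∈ A, ∃! b, N.pair a b ∈ F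

/-- `F` is (the graph of) a bijection from `A` to `B`. -/
def IsBijection (N : L2Structure.{u}) (F A B : Set N.M) : Prop :=
  N.IsFunction F A B ∧ ∀ b ∈ B, ∃! a, a ∈ A ∧ N.pair a b ∈ F

/-! ### The chain/antichain principle -/

/-- `R`, read as `x ≤ y ↔ ⟨x, y⟩ ∈ R`, is a partial order on `P`. -/
structure IsPartialOrder (N : L2Structure.{u}) (P R : Set N.M) : Prop where
  subset : R ⊆ N.prod P P
  refl : ∀ x ∈ P, N.pair x x ∈ R
  antisymm : ∀ x ∈ P, ∀ y ∈ P, N.pair x y ∈ R → N.pair y x ∈ R → x = y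
  trans : ∀ x ∈ P, ∀ y ∈ P, ∀ z ∈ P, N.pair x y ∈ R → N.pair y z ∈ R → N.pair x z ∈ R

/-- `Y` is a chain under `R`. -/
def IsChain (N : L2Structure.{u}) (R Y : Set N.M) : Prop :=
  ∀ x ∈ Y, ∀ y ∈ Y, N.pair x y ∈ R ∨ N.pair y x ∈ R

/-- `Y` is an antichain under `R`. -/
def IsAntichain (N : L2Structure.{u}) (R Y : Set N.M) : Prop :=
  ∀ x ∈ Y, ∀ y ∈ Y, x ≠ y → N.pair x y ∉ R ∧ N.pair y x ∉ R

/-- `CAC`: every infinite partial order has an infinite chain or an infinite antichain. -/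
def CAC (N : L2Structure.{u}) : Prop :=
  ∀ P ∈ N.sets, ∀ R ∈ N.sets, N.IsPartialOrder P R → N.Infinite P →
    ∃ Y ∈ N.sets, Y ⊆ P ∧ N.Infinite Y ∧ (N.IsChain R Y ∨ N.IsAntichain R Y)

/-! ### Countable second-countable spaces -/

/-- The `n`-th member `Uₙ = {x | ⟨n, x⟩ ∈ U}` of the sequence of sets coded by `U`. -/
def member (N : L2Structure.{u}) (U : Set N.M) (n : N.M) : Set N.M :=
  {x | N.pair n x ∈ U}

/-- `⟨X, U, k⟩` is a countable second-countable (CSC) space of the structure `N`. The argument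
`(x, m, n)` of `k` is coded as `⟨⟨x, m⟩, n⟩`. -/
structure IsCSCSpace (N : L2Structure.{u}) (X U k : Set N.M) : Prop where
  X_mem : X ∈ N.sets
  U_mem : U ∈ N.sets
  k_mem : k ∈ N.sets
  subset : ∀ n, N.member U n ⊆ X
  cover : ∀ x ∈ X, ∃ n, x ∈ N.member U n
  isFunction : N.IsFunction k (N.prod (N.prod X Set.univ) Set.univ) Set.univ
  inter : ∀ x ∈ X, ∀ m n, x ∈ N.member U m ∩ N.member U n →
    ∀ j, N.pair (N.pair (N.pair x m) n) j ∈ k →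
      x ∈ N.member U j ∧ N.member U j ⊆ N.member U n ∩ N.member U m

/-- `C` is the closure relation on the space with points `X` and basis `U`: `⟨y, x⟩ ∈ C` if and
only if every basic open set that contains `y` also contains `x`. -/
def IsClosureRelation (N : L2Structure.{u}) (X U C : Set N.M) : Prop :=
  C ⊆ N.prod X X ∧
    ∀ y ∈ X, ∀ x ∈ X, (N.pair y x ∈ C ↔ ∀ n, y ∈ N.member U n → x ∈ N.member U n)

/-- The basic open sets `Uₙ ∩ Y` of the subspace `Y` of the space with basis `U`. -/
def subspaceBasis (N : L2Structure.{u}) (U Y : Set N.M) (n : N.M) : Set N.M :=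
  N.member U n ∩ Y

/-- The set `{h(i) : i ≤ j}` for a function `h` with graph `H`. -/
def initialImage (N : L2Structure.{u}) (H : Set N.M) (j : N.M) : Set N.M :=
  {x | ∃ i, N.le i j ∧ N.pair i x ∈ H}

/-- The set `{h(i) : i ≥ j}` for a function `h` with graph `H`. -/
def finalImage (N : L2Structure.{u}) (H : Set N.M) (j : N.M) : Set N.M :=
  {x | ∃ i, N.le j i ∧ N.pair i x ∈ H}

/-- The space with points `Y` and basic open sets `W n` is `T₁`. -/
def IsT1 (N : L2Structure.{u}) (Y : Set N.M) (W : N.M → Set N.M) : Prop :=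
  ∀ x ∈ Y, ∀ y ∈ Y, x ≠ y → ∃ m n, x ∈ W m \ W n ∧ y ∈ W n \ W m

/-- The space with points `Y` and basic open sets `W n` is indiscrete: no basic open set other
than `∅` and `Y`. -/
def IsIndiscrete (N : L2Structure.{u}) (Y : Set N.M) (W : N.M → Set N.M) : Prop :=
  ∀ n, W n = ∅ ∨ W n = Y

/-- The space with points `Y` and basic open sets `W n` has the initial segment topology: for some
bijection `h` from the numbers to `Y`, the basic open sets are, apart from `∅` and `Y` (which
may or may not be listed in the basis), exactly the sets `{h(i) : i ≤ j}`. -/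
def HasInitialSegmentTopology (N : L2Structure.{u}) (Y : Set N.M) (W : N.M → Set N.M) : Prop :=
  ∃ H ∈ N.sets, N.IsBijection H Set.univ Y ∧
    (∀ n, W n = ∅ ∨ W n = Y ∨ ∃ j, W n = N.initialImage H j) ∧
    ∀ j, ∃ n, W n = N.initialImage H j

/-- The space with points `Y` and basic open sets `W n` has the final segment topology: for some
bijection `h` from the numbers to `Y`, the basic open sets are, apart from `∅` (which may or
may not be listed in the basis), exactly the sets `{h(i) : i ≥ j}`. For `j = 0` this is `Y`. -/
def HasFinalSegmentTopology (N : L2Structure.{u}) (Y : Set N.M) (W : N.M → Set N.M) : Prop :=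
  ∃ H ∈ N.sets, N.IsBijection H Set.univ Y ∧
    (∀ n, W n = ∅ ∨ W n = Y ∨ ∃ j, W n = N.finalImage H j) ∧
    ∀ j, ∃ n, W n = N.finalImage H j

/-- `wGS^cl`, the weak Ginsburg–Sands principle for spaces with a closure relation: every infinite
CSC space whose closure relation exists has an infinite subspace which is indiscrete, has the
initial segment topology, has the final segment topology, or is `T₁`. -/
def WGScl (N : L2Structure.{u}) : Prop :=
  ∀ X U k : Set N.M, N.IsCSCSpace X U k → N.Infinite X →
    (∃ C ∈ N.sets, N.IsClosureRelation X U C) →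
    ∃ Y ∈ N.sets, Y ⊆ X ∧ N.Infinite Y ∧
      (N.IsIndiscrete Y (N.subspaceBasis U Y) ∨
        N.HasInitialSegmentTopology Y (N.subspaceBasis U Y) ∨
        N.HasFinalSegmentTopology Y (N.subspaceBasis U Y) ∨
        N.IsT1 Y (N.subspaceBasis U Y))

end L2Structure

/-!
Both directions pass through the specialization preorder of a space: `x` is below `y` when every
basic open set that contains `x` contains `y`. The closure relation is this preorder.

If every infinite partial order has an infinite chain or antichain, then every transitive relation
`T` has an infinite set on which either `T x y` holds for all `x < y`, or `T x y` fails for all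
`x < y` (`CAC.exists_homogeneous`, applied to the order `x = y ∨ (x < y ∧ T x y)`). Three
applications, with `T` the strict specialization order, its converse, and the equivalence it
induces, yield an infinite subspace on which `x < y` always means that `x` is strictly below `y`,
or strictly above `y`, or equivalent to `y`, or incomparable with `y`. In the last two cases the
subspace is indiscrete or `T₁`. In the first two, least and greatest elements, which exist by
induction, show that its nonempty basic open sets are final segments, or initial segments and the
whole space, and that all segments occur (`hasFinalSegmentTopology`, `hasInitialSegmentTopology`).
The definition of these topologies asks for a bijection from the numbers onto the points; it is the
increasing enumeration, which `exists_enumeration` obtains by iterating the function that sends a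
number to the next element of the set.

Conversely, a partial order is the specialization order of the space whose basic open sets are the
cones `{y | x ≤ y}`. An infinite subspace whose basic open sets are nested is a chain, and a `T₁`
subspace is an antichain (`WGScl.cac`).

As the first-order part may be nonstandard, the arithmetic is derived inside the model: the number
sort is an ordered commutative semiring, and iteration of functions in `RCA₀` needs codes for finite
sets. A finite set `X` below `b` is coded by numbers `m` and `n` such that `m * (z + 1) + 1 ∣ n` if
and only if `z ∈ X`, for `z < b` (`exists_decode_eq`); with `m` a multiple of all positive numbers
up to `b`, the moduli are pairwise coprime, which is used in the elementary form
`dvd_mul_iff_of_ne`.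

To apply the induction and comprehension schemes, predicates on assignments are shown to be defined
by `Δ⁰₀` formulas through the closure properties of the classes `IsTermFun` and `IsDelta0`, so that
type class inference finds the formulas.
-/

/-! ### Definability -/

namespace L2Structure

variable {N : L2Structure.{u}}

instance : Zero N.M := ⟨N.zero⟩
instance : One N.M := ⟨N.one⟩
instance : Add N.M := ⟨N.add⟩
instance : Mul N.M := ⟨N.mul⟩
instance : LT N.M := ⟨N.lt⟩
instance : LE N.M := ⟨N.le⟩

/-- The function `f` of assignments is given by a term with number parameters from `N`. The first
`k` variables are the free ones; the parameters, listed in `A`, may be read off from any sequence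
`p` that contains them, and occupy the variables from `k` on. Quantifying over `p` lets several
terms and formulas share one sequence of parameters. -/
class IsTermFun (N : L2Structure.{u}) (k : ℕ) (f : (ℕ → N.M) → N.M) : Prop where
  exists_term : ∃ A : List N.M, ∀ p : ℕ → N.M, (∀ a ∈ A, ∃ i, p i = a) →
    ∃ t : L2Term, ∀ w : ℕ → N.M, (∀ i, w (i + k) = p i) → t.eval N w = f w

/-- The predicate `P` on assignments is given by a `Δ⁰₀` formula with number and set parameters from
`N`. The first `k` number variables are the free ones; the number parameters (listed in `A`) and the
set parameters (listed in `B`) may be read off from any sequences `p` and `V` that contain them. -/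
class IsDelta0 (N : L2Structure.{u}) (k : ℕ) (P : (ℕ → N.M) → Prop) : Prop where
  exists_formula : ∃ (A : List N.M) (B : List (Set N.M)), (∀ S ∈ B, S ∈ N.sets) ∧
    ∀ (p : ℕ → N.M) (V : ℕ → Set N.M), (∀ a ∈ A, ∃ i, p i = a) → (∀ S ∈ B, ∃ i, V i = S) →
      ∃ θ : Delta0Formula, ∀ w : ℕ → N.M, (∀ i, w (i + k) = p i) → (θ.Realize N V w ↔ P w)

theorem pair_eq (a b : N.M) : N.pair a b = (a + b) * (a + b) + a := rfl

section Definability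

variable {k : ℕ} {f g : (ℕ → N.M) → N.M} {P Q : (ℕ → N.M) → Prop}

instance (priority := low) isTermFun_const (a : N.M) : IsTermFun N k (fun _ => a) :=
  ⟨[a], fun p hp => by
    obtain ⟨i, rfl⟩ := hp a (by simp)
    exact ⟨.var (i + k), fun w hw => hw i⟩⟩

instance isTermFun_var (i : ℕ) : IsTermFun N k (fun w => w i) :=
  ⟨[], fun _ _ => ⟨.var i, fun _ _ => rfl⟩⟩

theorem isTermFun_map₂ {op : N.M → N.M → N.M} {c : L2Term → L2Term → L2Term}
    (h : ∀ s t w, (c s t).eval N w = op (s.eval N w) (t.eval N w))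
    (hf : IsTermFun N k f) (hg : IsTermFun N k g) : IsTermFun N k (fun w => op (f w) (g w)) := by
  obtain ⟨A, hA⟩ := hf
  obtain ⟨B, hB⟩ := hg
  refine ⟨A ++ B, fun p hp => ?_⟩
  obtain ⟨s, hs⟩ := hA p fun a ha => hp a (by simp [ha])
  obtain ⟨t, ht⟩ := hB p fun a ha => hp a (by simp [ha])
  exact ⟨c s t, fun w hw => by rw [h, hs w hw, ht w hw]⟩

instance isTermFun_add [hf : IsTermFun N k f] [hg : IsTermFun N k g] :
    IsTermFun N k (fun w => f w + g w) :=
  isTermFun_map₂ (c := .add) (fun _ _ _ => rfl) hf hg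

instance isTermFun_mul [hf : IsTermFun N k f] [hg : IsTermFun N k g] :
    IsTermFun N k (fun w => f w * g w) :=
  isTermFun_map₂ (c := .mul) (fun _ _ _ => rfl) hf hg

instance isTermFun_pair [IsTermFun N k f] [IsTermFun N k g] :
    IsTermFun N k (fun w => N.pair (f w) (g w)) :=
  inferInstanceAs (IsTermFun N k (fun w => (f w + g w) * (f w + g w) + f w))

/-- Weakening by a new variable with index `0`. It is not an instance, as its conclusion is not a
higher-order pattern; it is needed for terms below a bounded quantifier that are not explicitly
given. -/
theorem IsTermFun.shift (hf : IsTermFun N k f) :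
    IsTermFun N (k + 1) (fun w => f (fun i => w (i + 1))) := by
  obtain ⟨A, hA⟩ := hf
  refine ⟨A, fun p hp => ?_⟩
  obtain ⟨t, ht⟩ := hA p hp
  have key : ∀ t : L2Term, ∃ t' : L2Term, ∀ w : ℕ → N.M,
      t'.eval N w = t.eval N (fun i => w (i + 1)) := by
    intro t
    induction t with
    | var i => exact ⟨.var (i + 1), fun _ => rfl⟩
    | zero => exact ⟨.zero, fun _ => rfl⟩
    | one => exact ⟨.one, fun _ => rfl⟩
    | add s t hs ht =>
      obtain ⟨s', hs⟩ := hs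
      obtain ⟨t', ht⟩ := ht
      exact ⟨.add s' t', fun w => by simp only [L2Term.eval, hs, ht]⟩
    | mul s t hs ht =>
      obtain ⟨s', hs⟩ := hs
      obtain ⟨t', ht⟩ := ht
      exact ⟨.mul s' t', fun w => by simp only [L2Term.eval, hs, ht]⟩
  obtain ⟨t', ht'⟩ := key t
  exact ⟨t', fun w hw => by rw [ht', ht _ fun i => hw i]⟩

theorem isDelta0_of_terms {r : N.M → N.M → Prop} {c : L2Term → L2Term → Delta0Formula}
    (h : ∀ V s t w, (c s t).Realize N V w ↔ r (s.eval N w) (t.eval N w))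
    (hf : IsTermFun N k f) (hg : IsTermFun N k g) : IsDelta0 N k (fun w => r (f w) (g w)) := by
  obtain ⟨A, hA⟩ := hf
  obtain ⟨B, hB⟩ := hg
  refine ⟨A ++ B, [], by simp, fun p V hp _ => ?_⟩
  obtain ⟨s, hs⟩ := hA p fun a ha => hp a (by simp [ha])
  obtain ⟨t, ht⟩ := hB p fun a ha => hp a (by simp [ha])
  exact ⟨c s t, fun w hw => by rw [h, hs w hw, ht w hw]⟩

instance isDelta0_eq [hf : IsTermFun N k f] [hg : IsTermFun N k g] :
    IsDelta0 N k (fun w => f w = g w) :=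
  isDelta0_of_terms (c := .eq) (fun _ _ _ _ => Iff.rfl) hf hg

instance isDelta0_lt [hf : IsTermFun N k f] [hg : IsTermFun N k g] :
    IsDelta0 N k (fun w => f w < g w) :=
  isDelta0_of_terms (c := .lt) (fun _ _ _ _ => Iff.rfl) hf hg

instance isDelta0_mem [hf : IsTermFun N k f] {S : Set N.M} [hS : Fact (S ∈ N.sets)] :
    IsDelta0 N k (fun w => f w ∈ S) := by
  obtain ⟨A, hA⟩ := hf
  refine ⟨A, [S], by simpa using hS.out, fun p V hp hV => ?_⟩
  obtain ⟨t, ht⟩ := hA p hp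
  obtain ⟨i, rfl⟩ := hV S (by simp)
  exact ⟨.mem t i, fun w hw => by rw [← ht w hw]; exact Iff.rfl⟩

instance isDelta0_not [hP : IsDelta0 N k P] : IsDelta0 N k (fun w => ¬ P w) := by
  obtain ⟨A, B, hB, h⟩ := hP
  refine ⟨A, B, hB, fun p V hp hV => ?_⟩
  obtain ⟨θ, hθ⟩ := h p V hp hV
  exact ⟨.not θ, fun w hw => not_congr (hθ w hw)⟩

instance isDelta0_and [hP : IsDelta0 N k P] [hQ : IsDelta0 N k Q] :
    IsDelta0 N k (fun w => P w ∧ Q w) := by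
  obtain ⟨A, B, hB, h⟩ := hP
  obtain ⟨A', B', hB', h'⟩ := hQ
  refine ⟨A ++ A', B ++ B', fun S hS => (List.mem_append.1 hS).elim (hB S) (hB' S),
    fun p V hp hV => ?_⟩
  obtain ⟨θ, hθ⟩ := h p V (fun a ha => hp a (by simp [ha])) (fun a ha => hV a (by simp [ha]))
  obtain ⟨θ', hθ'⟩ := h' p V (fun a ha => hp a (by simp [ha])) (fun a ha => hV a (by simp [ha]))
  exact ⟨.and θ θ', fun w hw => and_congr (hθ w hw) (hθ' w hw)⟩

theorem IsDelta0.congr (hP : IsDelta0 N k P) (h : ∀ w, P w ↔ Q w) : IsDelta0 N k Q := by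
  rwa [← show P = Q from funext fun w => propext (h w)]

instance isDelta0_or [IsDelta0 N k P] [IsDelta0 N k Q] : IsDelta0 N k (fun w => P w ∨ Q w) :=
  IsDelta0.congr (P := fun w => ¬ (¬ P w ∧ ¬ Q w)) inferInstance fun w => by tauto

instance isDelta0_imp [IsDelta0 N k P] [IsDelta0 N k Q] : IsDelta0 N k (fun w => P w → Q w) :=
  IsDelta0.congr (P := fun w => ¬ P w ∨ Q w) inferInstance fun w => by tauto

instance isDelta0_iff [IsDelta0 N k P] [IsDelta0 N k Q] : IsDelta0 N k (fun w => P w ↔ Q w) :=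
  IsDelta0.congr (P := fun w => (P w → Q w) ∧ (Q w → P w)) inferInstance fun w => by tauto

instance isDelta0_le [IsTermFun N k f] [IsTermFun N k g] : IsDelta0 N k (fun w => f w ≤ g w) :=
  inferInstanceAs (IsDelta0 N k fun w => f w < g w ∨ f w = g w)

instance isDelta0_exLt {R : N.M → (ℕ → N.M) → Prop} [hf : IsTermFun N k f]
    [hR : IsDelta0 N (k + 1) (fun w => R (w 0) (fun i => w (i + 1)))] :
    IsDelta0 N k (fun w => ∃ x, x < f w ∧ R x w) := by
  obtain ⟨A, hA⟩ := hf
  obtain ⟨A', B, hB, h⟩ := hR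
  refine ⟨A ++ A', B, hB, fun p V hp hV => ?_⟩
  obtain ⟨t, ht⟩ := hA p fun a ha => hp a (by simp [ha])
  obtain ⟨θ, hθ⟩ := h p V (fun a ha => hp a (by simp [ha])) hV
  refine ⟨.exLt t θ, fun w hw => exists_congr fun x => ?_⟩
  rw [ht w hw]
  exact and_congr_right fun _ => hθ (consAssignment x w) hw

instance isDelta0_allLt {R : N.M → (ℕ → N.M) → Prop} [IsTermFun N k f]
    [IsDelta0 N (k + 1) (fun w => R (w 0) (fun i => w (i + 1)))] :
    IsDelta0 N k (fun w => ∀ x, x < f w → R x w) :=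
  IsDelta0.congr (P := fun w => ¬ ∃ x, x < f w ∧ ¬ R x w) inferInstance fun w => by
    push Not; rfl

/-- Two `Δ⁰₀` predicates are defined by formulas with the same parameters. -/
theorem IsDelta0.exists_realize {P : (ℕ → N.M) → Prop} {Q : (ℕ → N.M) → Prop}
    (hne : N.sets.Nonempty) (hP : IsDelta0 N k P) (hQ : IsDelta0 N k Q) :
    ∃ (V : ℕ → Set N.M) (v : ℕ → N.M) (θ ψ : Delta0Formula), (∀ i, V i ∈ N.sets) ∧
      ∀ w : ℕ → N.M, (∀ i, w (i + k) = v i) →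
        (θ.Realize N V w ↔ P w) ∧ (ψ.Realize N V w ↔ Q w) := by
  obtain ⟨A, B, hB, h⟩ := hP
  obtain ⟨A', B', hB', h'⟩ := hQ
  obtain ⟨S₀, hS₀⟩ := hne
  have key : ∀ {α : Type u} (L : List α) (d a : α), a ∈ L → ∃ i, L.getD i d = a := by
    intro α L d a ha
    obtain ⟨i, hi, rfl⟩ := List.getElem_of_mem ha
    exact ⟨i, by simp [hi]⟩
  obtain ⟨θ, hθ⟩ := h (fun i => (A ++ A').getD i 0) (fun i => (B ++ B').getD i S₀)
    (fun a ha => key _ _ _ (by simp [ha])) (fun a ha => key _ _ _ (by simp [ha]))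
  obtain ⟨ψ, hψ⟩ := h' (fun i => (A ++ A').getD i 0) (fun i => (B ++ B').getD i S₀)
    (fun a ha => key _ _ _ (by simp [ha])) (fun a ha => key _ _ _ (by simp [ha]))
  refine ⟨_, _, θ, ψ, fun i => ?_, fun w hw => ⟨hθ w hw, hψ w hw⟩⟩
  by_cases hi : i < (B ++ B').length
  · rw [List.getD_eq_getElem _ _ hi]
    exact (List.mem_append.1 (List.getElem_mem hi)).elim (hB _) (hB' _)
  · rwa [List.getD_eq_default _ _ (not_lt.1 hi)]

end Definability

/-! ### Induction and comprehension -/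

variable [hN : Fact N.IsModelRCA0]

/-- The `Σ⁰₁` induction scheme. As in `L2Structure.Sigma1`, the variable with index `0` is the
witness `y` and the variable with index `1` is `n`. -/
theorem sigma1_induction {P : N.M → N.M → Prop} [hP : IsDelta0 N 2 (fun w => P (w 1) (w 0))]
    (h0 : ∃ y, P 0 y) (hs : ∀ n, (∃ y, P n y) → ∃ y, P (n + 1) y) (n : N.M) : ∃ y, P n y := by
  obtain ⟨V, v, θ, _, hV, h⟩ := hP.exists_realize hN.out.sets_nonempty hP
  have h' : ∀ n, N.Sigma1 θ V v n ↔ ∃ y, P n y := fun n =>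
    exists_congr fun y => (h (consAssignment y (consAssignment n v)) fun _ => rfl).1
  refine (h' n).1 (hN.out.sigma1Induction θ V v hV ((h' _).2 h0) (fun n hn => ?_) n)
  exact (h' _).2 (hs n ((h' n).1 hn))

theorem delta0_induction {P : N.M → Prop} [IsDelta0 N 2 (fun w => P (w 1))]
    (h0 : P 0) (hs : ∀ n, P n → P (n + 1)) (n : N.M) : P n :=
  (sigma1_induction (P := fun n _ => P n) ⟨0, h0⟩ (fun n ⟨_, h⟩ => ⟨0, hs n h⟩) n).choose_spec

/-- Comprehension for a predicate `∃ y, P n y` that is equivalent to `∀ y, Q n y`. -/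
theorem delta1_comprehension {P Q : N.M → N.M → Prop}
    [hP : IsDelta0 N 2 (fun w => P (w 1) (w 0))] [hQ : IsDelta0 N 2 (fun w => Q (w 1) (w 0))]
    (hPQ : ∀ n, (∃ y, P n y) ↔ ∀ y, Q n y) : ∃ X ∈ N.sets, ∀ n, n ∈ X ↔ ∃ y, P n y := by
  obtain ⟨V, v, θ, ψ, hV, h⟩ := hP.exists_realize hN.out.sets_nonempty hQ
  have hθ : ∀ n, N.Sigma1 θ V v n ↔ ∃ y, P n y := fun n =>
    exists_congr fun y => (h (consAssignment y (consAssignment n v)) fun _ => rfl).1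
  have hψ : ∀ n, N.Pi1 ψ V v n ↔ ∀ y, Q n y := fun n =>
    forall_congr' fun y => (h (consAssignment y (consAssignment n v)) fun _ => rfl).2
  obtain ⟨X, hX, hX'⟩ := hN.out.delta1Comprehension θ ψ V v hV fun n => by rw [hθ, hψ, hPQ]
  exact ⟨X, hX, fun n => by rw [hX', hθ]⟩

/-- `Δ⁰₀` comprehension. The variable with index `0`, the witness of the `Σ⁰₁` form, does not occur,
hence the index `1`. -/
theorem delta0_comprehension {P : N.M → Prop} [IsDelta0 N 2 (fun w => P (w 1))] :
    {n | P n} ∈ N.sets := by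
  obtain ⟨X, hX, h⟩ := delta1_comprehension (N := N) (P := fun n _ => P n) (Q := fun n _ => P n)
    fun n => ⟨fun ⟨_, h⟩ _ => h, fun h => ⟨0, h 0⟩⟩
  rwa [show {n | P n} = X from Set.ext fun n => by simp [h]]

/-! ### Arithmetic

The laws of arithmetic, from the basic axioms and induction. They carry the names of the
corresponding facts of Mathlib, which become available once the algebraic and order instances are
declared. -/

namespace Arith

theorem add_zero (a : N.M) : a + 0 = a := hN.out.basic.add_zero a
theorem add_succ (a b : N.M) : a + (b + 1) = a + b + 1 := hN.out.basic.add_succ a b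
theorem mul_zero (a : N.M) : a * 0 = 0 := hN.out.basic.mul_zero a
theorem mul_succ (a b : N.M) : a * (b + 1) = a * b + a := hN.out.basic.mul_succ a b
theorem succ_ne_zero (a : N.M) : a + 1 ≠ 0 := hN.out.basic.succ_ne_zero a
theorem succ_inj {a b : N.M} (h : a + 1 = b + 1) : a = b := hN.out.basic.succ_inj a b h
theorem not_lt_zero (a : N.M) : ¬ a < 0 := hN.out.basic.not_lt_zero a
theorem lt_succ_iff {a b : N.M} : a < b + 1 ↔ a < b ∨ a = b := hN.out.basic.lt_succ_iff a b

theorem add_assoc (a b c : N.M) : a + b + c = a + (b + c) := by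
  refine delta0_induction (P := fun c => a + b + c = a + (b + c)) ?_ (fun c h => ?_) c
  · rw [add_zero, add_zero]
  · rw [add_succ, h, add_succ, add_succ]

theorem zero_add (a : N.M) : 0 + a = a := by
  refine delta0_induction (P := fun a => 0 + a = a) (add_zero 0) (fun a h => ?_) a
  rw [add_succ, h]

theorem succ_add (a b : N.M) : a + 1 + b = a + b + 1 := by
  refine delta0_induction (P := fun b => a + 1 + b = a + b + 1) ?_ (fun b h => ?_) b
  · rw [add_zero, add_zero]
  · rw [add_succ, h, add_succ]

theorem add_comm (a b : N.M) : a + b = b + a := by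
  refine delta0_induction (P := fun b => a + b = b + a) ?_ (fun b h => ?_) b
  · rw [add_zero, zero_add]
  · rw [add_succ, h, succ_add]

theorem mul_add (a b c : N.M) : a * (b + c) = a * b + a * c := by
  refine delta0_induction (P := fun c => a * (b + c) = a * b + a * c) ?_ (fun c h => ?_) c
  · rw [add_zero, mul_zero, add_zero]
  · rw [add_succ, mul_succ, h, mul_succ, add_assoc]

theorem zero_mul (a : N.M) : 0 * a = 0 := by
  refine delta0_induction (P := fun a => 0 * a = 0) (mul_zero 0) (fun a h => ?_) a
  rw [mul_succ, h, add_zero]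

theorem succ_mul (a b : N.M) : (a + 1) * b = a * b + b := by
  refine delta0_induction (P := fun b => (a + 1) * b = a * b + b) ?_ (fun b h => ?_) b
  · rw [mul_zero, mul_zero, add_zero]
  · rw [mul_succ, h, mul_succ, ← add_assoc, ← add_assoc, add_assoc (a * b), add_comm b a,
      ← add_assoc]

theorem mul_comm (a b : N.M) : a * b = b * a := by
  refine delta0_induction (P := fun b => a * b = b * a) ?_ (fun b h => ?_) b
  · rw [mul_zero, zero_mul]
  · rw [mul_succ, h, succ_mul]

theorem mul_assoc (a b c : N.M) : a * b * c = a * (b * c) := by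
  refine delta0_induction (P := fun c => a * b * c = a * (b * c)) ?_ (fun c h => ?_) c
  · rw [mul_zero, mul_zero, mul_zero]
  · rw [mul_succ, h, mul_succ, mul_add]

theorem mul_one (a : N.M) : a * 1 = a := by
  rw [← zero_add (1 : N.M), mul_succ, mul_zero, zero_add]

theorem eq_zero_or_succ (a : N.M) : a = 0 ∨ ∃ b, a = b + 1 := by
  have : ∃ b, a = 0 ∨ a = b + 1 :=
    sigma1_induction (P := fun a b => a = 0 ∨ a = b + 1) ⟨0, Or.inl rfl⟩
      (fun a _ => ⟨a, Or.inr rfl⟩) a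
  obtain ⟨b, h⟩ := this
  exact h.imp_right fun h => ⟨b, h⟩

theorem lt_add_succ (a b : N.M) : a < a + (b + 1) := by
  refine delta0_induction (P := fun b => a < a + (b + 1)) ?_ (fun b h => ?_) b
  · rw [add_succ, add_zero]
    exact lt_succ_iff.2 (Or.inr rfl)
  · rw [add_succ]
    exact lt_succ_iff.2 (Or.inl h)

theorem exists_of_lt {a b : N.M} (h : a < b) : ∃ c, a + (c + 1) = b := by
  obtain ⟨c, hc⟩ := sigma1_induction (P := fun b c => a < b → a + (c + 1) = b)
    ⟨0, fun h => (not_lt_zero a h).elim⟩ (fun b ⟨c, hc⟩ => by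
      by_cases hab : a < b
      · exact ⟨c + 1, fun _ => by rw [add_succ, hc hab]⟩
      · refine ⟨0, fun h => ?_⟩
        rw [(lt_succ_iff.1 h).resolve_left hab, zero_add]) b
  exact ⟨c, hc h⟩

theorem lt_iff {a b : N.M} : a < b ↔ ∃ c, a + (c + 1) = b :=
  ⟨exists_of_lt, fun ⟨c, hc⟩ => hc ▸ lt_add_succ a c⟩

theorem le_iff {a b : N.M} : a ≤ b ↔ ∃ c, a + c = b := by
  change a < b ∨ a = b ↔ _
  rw [lt_iff]
  constructor
  · rintro (⟨c, rfl⟩ | rfl)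
    exacts [⟨_, rfl⟩, ⟨0, add_zero a⟩]
  · rintro ⟨c, rfl⟩
    rcases eq_zero_or_succ c with rfl | ⟨d, rfl⟩
    exacts [Or.inr (add_zero a).symm, Or.inl ⟨d, rfl⟩]

theorem add_right_cancel {a b c : N.M} : a + c = b + c → a = b := by
  refine delta0_induction (P := fun c => a + c = b + c → a = b) ?_ (fun c h => ?_) c
  · rw [add_zero, add_zero]; exact id
  · rw [add_succ, add_succ]; exact fun h' => h (succ_inj h')

theorem eq_zero_of_add_eq {a b : N.M} (h : a + b = a) : b = 0 :=
  add_right_cancel (c := a) (by rw [zero_add, add_comm, h])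

theorem lt_irrefl (a : N.M) : ¬ a < a := fun h => by
  obtain ⟨c, hc⟩ := lt_iff.1 h
  exact succ_ne_zero c (eq_zero_of_add_eq hc)

theorem lt_trans {a b c : N.M} (h : a < b) (h' : b < c) : a < c := by
  obtain ⟨d, rfl⟩ := lt_iff.1 h
  obtain ⟨e, rfl⟩ := lt_iff.1 h'
  exact lt_iff.2 ⟨d + 1 + e, by rw [add_assoc a, ← add_succ]⟩

theorem lt_or_le (a b : N.M) : a < b ∨ b ≤ a := by
  refine delta0_induction (P := fun b => a < b ∨ b ≤ a) ?_ (fun b h => ?_) b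
  · exact Or.inr (le_iff.2 ⟨a, zero_add a⟩)
  · rcases h with h | h | rfl
    · exact Or.inl (lt_succ_iff.2 (Or.inl h))
    · obtain ⟨d, rfl⟩ := lt_iff.1 h
      exact Or.inr (le_iff.2 ⟨d, by rw [succ_add, add_succ]⟩)
    · exact Or.inl (lt_succ_iff.2 (Or.inr rfl))

end Arith

/-! ### The ordered semiring of numbers -/

instance : CommSemiring N.M where
  add_assoc := Arith.add_assoc
  zero_add := Arith.zero_add
  add_zero := Arith.add_zero
  add_comm := Arith.add_comm
  left_distrib := Arith.mul_add
  right_distrib a b c := by rw [Arith.mul_comm, Arith.mul_add, Arith.mul_comm c, Arith.mul_comm c]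
  zero_mul := Arith.zero_mul
  mul_zero := Arith.mul_zero
  mul_assoc := Arith.mul_assoc
  one_mul a := by rw [Arith.mul_comm, Arith.mul_one]
  mul_one := Arith.mul_one
  mul_comm := Arith.mul_comm
  nsmul := nsmulRec

noncomputable instance : LinearOrder N.M where
  le_refl a := Or.inr rfl
  le_trans a b c h h' := by
    rcases h with h | rfl
    · rcases h' with h' | rfl
      exacts [Or.inl (Arith.lt_trans h h'), Or.inl h]
    · exact h'
  lt_iff_le_not_ge a b := by
    refine ⟨fun h => ⟨Or.inl h, ?_⟩, fun ⟨h, h'⟩ => h.resolve_right ?_⟩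
    · rintro (h' | rfl)
      exacts [Arith.lt_irrefl _ (Arith.lt_trans h h'), Arith.lt_irrefl _ h]
    · rintro rfl
      exact h' (Or.inr rfl)
  le_antisymm a b h h' := by
    rcases h with h | rfl
    · rcases h' with h' | rfl
      exacts [(Arith.lt_irrefl _ (Arith.lt_trans h h')).elim, rfl]
    · rfl
  le_total a b := (Arith.lt_or_le a b).imp_left Or.inl
  toDecidableLE := Classical.decRel _

instance : CanonicallyOrderedAdd N.M where
  exists_add_of_le h := (Arith.le_iff.1 h).imp fun _ h => h.symm
  le_self_add _ b := Arith.le_iff.2 ⟨b, rfl⟩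
  le_add_self a b := Arith.le_iff.2 ⟨b, Arith.add_comm a b⟩

theorem lt_add_one_iff {a b : N.M} : a < b + 1 ↔ a ≤ b := Arith.lt_succ_iff

instance : IsCancelAdd N.M where
  add_right_cancel _ _ _ := Arith.add_right_cancel
  add_left_cancel a b c h := Arith.add_right_cancel (c := a) (by rwa [add_comm b, add_comm c])

instance : IsOrderedCancelAddMonoid N.M where
  add_le_add_left a b h c := by
    obtain ⟨d, rfl⟩ := exists_add_of_le h
    exact Arith.le_iff.2 ⟨d, by ring⟩
  le_of_add_le_add_left a b c h := by
    obtain ⟨d, h⟩ := exists_add_of_le h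
    refine Arith.le_iff.2 ⟨d, ?_⟩
    rw [add_assoc] at h
    exact (add_left_cancel h).symm

theorem mul_lt_mul_left_of_pos (a b c : N.M) (hc : 0 < c) (h : a < b) : c * a < c * b := by
  obtain ⟨d, rfl⟩ := Arith.lt_iff.1 h
  obtain ⟨e, rfl⟩ := Arith.lt_iff.1 hc
  exact Arith.lt_iff.2 ⟨e * d + e + d, by ring⟩

instance : IsStrictOrderedRing N.M where
  zero_le_one := zero_le
  exists_pair_ne := ⟨0 + 1, 0, Arith.succ_ne_zero 0⟩
  mul_lt_mul_of_pos_left c hc a b h := mul_lt_mul_left_of_pos a b c hc h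
  mul_lt_mul_of_pos_right c hc a b h := by
    simpa only [mul_comm] using mul_lt_mul_left_of_pos a b c hc h

/-! ### Pairing -/

theorem one_le_of_ne_zero {a : N.M} (h : a ≠ 0) : 1 ≤ a := by
  obtain ⟨b, rfl⟩ := (Arith.eq_zero_or_succ a).resolve_left h
  exact le_add_self

theorem le_pair_left (a b : N.M) : a ≤ N.pair a b := le_add_self

theorem le_pair_right (a b : N.M) : b ≤ N.pair a b := by
  rcases eq_or_ne (a + b) 0 with h | h
  · rw [pair_eq, h, (add_eq_zero.1 h).2]
    exact zero_le
  · calc b ≤ a + b := le_add_self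
      _ ≤ (a + b) * (a + b) := le_mul_of_one_le_left zero_le
          (one_le_of_ne_zero h)
      _ ≤ N.pair a b := le_self_add

theorem sum_le_of_pair_eq {a b c d : N.M} (h : N.pair a b = N.pair c d) : a + b ≤ c + d := by
  by_contra! hlt
  obtain ⟨e, he⟩ := Arith.lt_iff.1 hlt
  refine Arith.lt_irrefl (N.pair c d) ?_
  conv_rhs => rw [← h, pair_eq, ← he]
  rw [pair_eq]
  refine Arith.lt_iff.2 ⟨2 * (c + d) * e + (c + d) + d + e * e + 2 * e + a, ?_⟩
  ring

theorem pair_inj {a b c d : N.M} : N.pair a b = N.pair c d ↔ a = c ∧ b = d := by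
  refine ⟨fun h => ?_, fun ⟨h, h'⟩ => by rw [h, h']⟩
  have hs : a + b = c + d := le_antisymm (sum_le_of_pair_eq h) (sum_le_of_pair_eq h.symm)
  rw [pair_eq, pair_eq, hs] at h
  obtain rfl := add_left_cancel h
  exact ⟨rfl, add_left_cancel hs⟩

theorem pair_mem_prod {a b : N.M} {A B : Set N.M} : N.pair a b ∈ N.prod A B ↔ a ∈ A ∧ b ∈ B := by
  constructor
  · rintro ⟨c, hc, d, hd, h⟩
    obtain ⟨rfl, rfl⟩ := pair_inj.1 h
    exact ⟨hc, hd⟩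
  · rintro ⟨ha, hb⟩
    exact ⟨a, ha, b, hb, rfl⟩

/-! ### Least and greatest elements -/

theorem exists_least {X : Set N.M} (hX : X ∈ N.sets) (hne : X.Nonempty) :
    ∃ a ∈ X, ∀ b ∈ X, a ≤ b := by
  have := Fact.mk hX
  by_contra! h
  have key : ∀ n, ∀ x < n, x ∉ X := by
    refine delta0_induction (P := fun n => ∀ x < n, x ∉ X) (fun x hx => ?_) fun n hn x hx hxX => ?_
    · exact (Arith.not_lt_zero x hx).elim
    · obtain ⟨b, hb, hbx⟩ := h x hxX
      exact hn b (hbx.trans_le (lt_add_one_iff.1 hx)) hb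
  obtain ⟨x, hx⟩ := hne
  exact key (x + 1) x (lt_add_one_iff.2 le_rfl) hx

theorem exists_greatest {X : Set N.M} (hX : X ∈ N.sets) (hne : X.Nonempty) {c : N.M}
    (hc : ∀ x ∈ X, x ≤ c) : ∃ a ∈ X, ∀ b ∈ X, b ≤ a := by
  have := Fact.mk hX
  -- The least upper bound belongs to `X`; the bound `c` makes being an upper bound `Δ⁰₀`.
  obtain ⟨u, hu, hmin⟩ := exists_least (X := {u | ∀ x < c + 1, x ∈ X → x ≤ u})
    delta0_comprehension ⟨c, fun x _ hx => hc x hx⟩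
  have hub : ∀ x ∈ X, x ≤ u := fun x hx => hu x (lt_add_one_iff.2 (hc x hx)) hx
  refine ⟨u, ?_, hub⟩
  obtain ⟨x, hx⟩ := hne
  rcases Arith.eq_zero_or_succ u with rfl | ⟨v, rfl⟩
  · rwa [← le_antisymm (hub x hx) zero_le]
  · by_contra huX
    have := hmin v fun y _ hy => lt_add_one_iff.1 <|
      (hub y hy).lt_of_ne fun h => huX (h ▸ hy)
    exact (lt_add_one_iff.2 le_rfl).not_ge this

/-! ### Coding of finite sets -/

instance isDelta0_dvd {k : ℕ} {f g : (ℕ → N.M) → N.M} [IsTermFun N k f] [IsTermFun N k g] :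
    IsDelta0 N k (fun w => f w ∣ g w) := by
  have := IsTermFun.shift (N := N) (k := k) (f := f) inferInstance
  have := IsTermFun.shift (N := N) (k := k) (f := g) inferInstance
  refine IsDelta0.congr (P := fun w => ∃ q, q < g w + 1 ∧ g w = f w * q) inferInstance fun w => ?_
  · refine ⟨fun ⟨q, _, h⟩ => ⟨q, h⟩, fun ⟨q, h⟩ => ?_⟩
    rcases eq_or_ne (f w) 0 with h0 | h0
    · exact ⟨0, lt_add_one_iff.2 zero_le, by rw [h, h0, zero_mul, zero_mul]⟩
    · exact ⟨q, lt_add_one_iff.2 (h ▸ le_mul_of_one_le_left zero_le (one_le_of_ne_zero h0)), h⟩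

theorem dvd_of_dvd_add {a b c : N.M} (h : a ∣ b + c) (hb : a ∣ b) : a ∣ c := by
  obtain ⟨u, rfl⟩ := hb
  obtain ⟨v, hv⟩ := h
  rcases le_total u v with h | h
  · obtain ⟨d, rfl⟩ := exists_add_of_le h
    rw [mul_add] at hv
    exact ⟨d, add_left_cancel hv⟩
  · have : a * v + c ≤ a * v := (by gcongr : a * v + c ≤ a * u + c).trans_eq hv
    have hc : c = 0 := by
      rw [← nonpos_iff_eq_zero]
      exact le_of_add_le_add_left (this.trans_eq (add_zero _).symm)
    exact hc ▸ dvd_zero a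

theorem exists_common_multiple (b : N.M) : ∃ m, m ≠ 0 ∧ ∀ d < b + 1, d ≠ 0 → d ∣ m := by
  refine sigma1_induction (P := fun b m => m ≠ 0 ∧ ∀ d < b + 1, d ≠ 0 → d ∣ m) ?_ ?_ b
  · refine ⟨1, one_ne_zero, fun d hd h => (h ?_).elim⟩
    rwa [lt_add_one_iff, nonpos_iff_eq_zero] at hd
  · rintro n ⟨m, hm, h⟩
    refine ⟨m * (n + 1), mul_ne_zero hm (Arith.succ_ne_zero n), fun d hd hd0 => ?_⟩
    rcases (lt_add_one_iff.1 hd).lt_or_eq with hd | rfl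
    · exact (h d hd hd0).mul_right _
    · exact dvd_mul_left _ _

/-- The moduli `a = m * (i + 1) + 1` and `c` are coprime when they differ by `m * d` and `d ∣ m`:
modulo `a`, the number `m` is invertible, hence so are its divisor `d` and `c`. As there is no
subtraction, the two signs of the difference are listed. -/
theorem dvd_of_dvd_mul {m n i d c : N.M} (hd : d ∣ m)
    (hc : c + m * d = m * (i + 1) + 1 ∨ c = m * (i + 1) + 1 + m * d)
    (h : m * (i + 1) + 1 ∣ n * c) : m * (i + 1) + 1 ∣ n := by
  set a := m * (i + 1) + 1 with ha
  have han : ∀ x : N.M, a ∣ x * m → a ∣ x := fun x hx => by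
    refine dvd_of_dvd_add (b := x * m * (i + 1)) ⟨x, ?_⟩ (hx.mul_right _)
    rw [ha]; ring
  have h1 : a ∣ n * m * d := by
    rcases hc with hc | hc
    · refine dvd_of_dvd_add (b := n * c) ?_ h
      rw [mul_assoc, ← mul_add, hc]
      exact dvd_mul_left a n
    · refine dvd_of_dvd_add (b := n * a) ?_ (dvd_mul_left a n)
      rwa [mul_assoc, ← mul_add, ← hc]
  have h2 : a ∣ n * d := han _ (by rwa [mul_right_comm])
  obtain ⟨e, rfl⟩ := hd
  exact han _ (by simpa only [mul_assoc] using h2.mul_right e)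

theorem dvd_mul_iff_of_ne {b m n i j : N.M} (hm : ∀ d < b + 1, d ≠ 0 → d ∣ m) (hi : i < b)
    (hj : j < b) (hij : i ≠ j) :
    m * (i + 1) + 1 ∣ n * (m * (j + 1) + 1) ↔ m * (i + 1) + 1 ∣ n := by
  refine ⟨fun h => ?_, fun h => h.mul_right _⟩
  rcases lt_or_gt_of_ne hij with h' | h'
  · obtain ⟨d, rfl⟩ := exists_add_of_le h'.le
    refine dvd_of_dvd_mul (c := m * (_ + 1) + 1) (hm d ?_ ?_) (Or.inr ?_) h
    · exact lt_add_one_iff.2 (le_add_self.trans hj.le)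
    · rintro rfl; simp at hij
    · ring
  · obtain ⟨d, rfl⟩ := exists_add_of_le h'.le
    refine dvd_of_dvd_mul (c := m * (_ + 1) + 1) (hm d ?_ ?_) (Or.inl ?_) h
    · exact lt_add_one_iff.2 (le_add_self.trans hi.le)
    · rintro rfl; simp at hij
    · ring

/-- The finite set with code `m`, `n` and bound `b`. -/
def decode (m n b : N.M) : Set N.M := {z | z < b ∧ m * (z + 1) + 1 ∣ n}

instance isDelta0_mem_decode {k : ℕ} {e f g h : (ℕ → N.M) → N.M} [IsTermFun N k e]
    [IsTermFun N k f] [IsTermFun N k g] [IsTermFun N k h] :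
    IsDelta0 N k (fun w => e w ∈ decode (f w) (g w) (h w)) :=
  inferInstanceAs (IsDelta0 N k fun w => e w < h w ∧ f w * (e w + 1) + 1 ∣ g w)

theorem decode_mem_sets (m n b : N.M) : decode m n b ∈ N.sets :=
  delta0_comprehension (P := fun z => z ∈ decode m n b)

/-- Every bounded set has a code: `n` is the product of the moduli `m * (z + 1) + 1` for `z ∈ X`. -/
theorem exists_decode_eq {X : Set N.M} (hX : X ∈ N.sets) {b : N.M} (hb : ∀ z ∈ X, z < b) :
    ∃ m n, decode m n b = X := by
  have := Fact.mk hX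
  obtain ⟨m, hm0, hm⟩ := exists_common_multiple b
  have key : ∀ j, ∃ n, ∀ z < b, (m * (z + 1) + 1 ∣ n ↔ z < j ∧ z ∈ X) := by
    refine sigma1_induction (P := fun j n => ∀ z < b, (m * (z + 1) + 1 ∣ n ↔ z < j ∧ z ∈ X)) ?_ ?_
    · refine ⟨1, fun z _ => iff_of_false (fun h => ?_) fun h => Arith.not_lt_zero z h.1⟩
      obtain ⟨q, hq⟩ := h
      have hq0 : q ≠ 0 := by rintro rfl; simp at hq
      have h1 : m * (z + 1) + 1 ≤ 1 :=
        (le_mul_of_one_le_right zero_le (one_le_of_ne_zero hq0)).trans_eq hq.symm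
      have h2 : m * (z + 1) ≤ 0 := le_of_add_le_add_right (h1.trans_eq (zero_add 1).symm)
      simp [hm0] at h2
    · rintro j ⟨n, hn⟩
      by_cases hj : j ∈ X
      · refine ⟨n * (m * (j + 1) + 1), fun z hz => ?_⟩
        rcases eq_or_ne z j with rfl | hzj
        · exact iff_of_true (dvd_mul_left _ _) ⟨lt_add_one_iff.2 le_rfl, hj⟩
        · rw [dvd_mul_iff_of_ne hm hz (hb j hj) hzj, hn z hz, lt_add_one_iff,
            hzj.le_iff_lt]
      · refine ⟨n, fun z hz => ?_⟩
        rw [hn z hz, lt_add_one_iff, le_iff_lt_or_eq]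
        constructor
        · exact fun h => ⟨Or.inl h.1, h.2⟩
        · rintro ⟨h | rfl, h'⟩
          exacts [⟨h, h'⟩, (hj h').elim]
  obtain ⟨n, hn⟩ := key b
  refine ⟨m, n, Set.ext fun z => ⟨fun h => ((hn z h.1).1 h.2).2, fun h => ?_⟩⟩
  exact ⟨hb z h, (hn z (hb z h)).2 ⟨hb z h, h⟩⟩

/-! ### Iteration of a function -/

/-- `S` is a set of pairs `⟨i, x⟩` each of which is `⟨0, a⟩` or is obtained from another pair in `S`
by one application of `F`, so that `⟨i, x⟩ ∈ S` witnesses that the `i`-th iterate of `F` at `a` is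
`x`. -/
def IsDerivation (F : Set N.M) (a : N.M) (S : Set N.M) : Prop :=
  ∀ z ∈ S, z = N.pair 0 a ∨
    ∃ j u v, z = N.pair (j + 1) v ∧ N.pair j u ∈ S ∧ N.pair u v ∈ F

/-- Some finite derivation with code below `y` contains `z`. All quantifiers are bounded, so that
the predicate is `Δ⁰₀`; `exists_iterCode_iff` relates it to `IsDerivation`. -/
def IterCode (F : Set N.M) (a z y : N.M) : Prop :=
  ∃ m < y, ∃ n < y, ∃ b < y, z ∈ decode m n b ∧ ∀ x < b, x ∈ decode m n b → x = N.pair 0 a ∨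
    ∃ j < b, ∃ u < b, ∃ v < b, x = N.pair (j + 1) v ∧ N.pair j u ∈ decode m n b ∧ N.pair u v ∈ F

instance isDelta0_iterCode {k : ℕ} {F : Set N.M} [Fact (F ∈ N.sets)] {a : N.M}
    {f g : (ℕ → N.M) → N.M} [hf : IsTermFun N k f] [hg : IsTermFun N k g] :
    IsDelta0 N k (fun w => IterCode F a (f w) (g w)) := by
  have hf1 := hf.shift
  have hf2 := hf1.shift
  have hf3 := hf2.shift
  have hg1 := hg.shift
  have hg2 := hg1.shift
  unfold IterCode
  infer_instance

theorem IterCode.mono {F : Set N.M} {a z y y' : N.M} (h : IterCode F a z y) (hy : y ≤ y') :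
    IterCode F a z y' := by
  obtain ⟨m, hm, n, hn, b, hb, h⟩ := h
  exact ⟨m, hm.trans_le hy, n, hn.trans_le hy, b, hb.trans_le hy, h⟩

theorem exists_iterCode_iff {F : Set N.M} {a z : N.M} : (∃ y, IterCode F a z y) ↔
    ∃ S ∈ N.sets, (∃ b, ∀ x ∈ S, x < b) ∧ IsDerivation F a S ∧ z ∈ S := by
  constructor
  · rintro ⟨y, m, -, n, -, b, -, hz, h⟩
    refine ⟨_, decode_mem_sets m n b, ⟨b, fun x hx => hx.1⟩, fun x hx => ?_, hz⟩
    refine (h x hx.1 hx).imp_right ?_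
    rintro ⟨j, -, u, -, v, -, h⟩
    exact ⟨j, u, v, h⟩
  · rintro ⟨S, hS, ⟨b, hb⟩, h, hz⟩
    obtain ⟨m, n, rfl⟩ := exists_decode_eq hS hb
    refine ⟨m + n + b + 1, m, ?_, n, ?_, b, ?_, hz, fun x hxb hx => (h x hx).imp_right ?_⟩
    · rw [lt_add_one_iff, add_assoc]; exact le_self_add
    · rw [lt_add_one_iff, add_right_comm]; exact le_add_self
    · rw [lt_add_one_iff]; exact le_add_self
    rintro ⟨j, u, v, rfl, hu, hv⟩
    exact ⟨j, (le_self_add.trans (le_pair_left _ _)).trans_lt hxb,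
      u, (le_pair_right _ _).trans_lt hu.1, v, (le_pair_right _ _).trans_lt hxb, rfl, hu, hv⟩

theorem IsDerivation.unique {F : Set N.M} (hF : ∀ x, ∃! y, N.pair x y ∈ F) {a : N.M}
    {S S' : Set N.M} (hS : S ∈ N.sets) (hS' : S' ∈ N.sets) {b b' : N.M} (hb : ∀ x ∈ S, x < b)
    (hb' : ∀ x ∈ S', x < b') (h : IsDerivation F a S) (h' : IsDerivation F a S') {i x x' : N.M}
    (hx : N.pair i x ∈ S) (hx' : N.pair i x' ∈ S') : x = x' := by
  have := Fact.mk hS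
  have := Fact.mk hS'
  have key : ∀ i, ∀ x < b, ∀ x' < b', N.pair i x ∈ S → N.pair i x' ∈ S' → x = x' := by
    refine delta0_induction
      (P := fun i => ∀ x < b, ∀ x' < b', N.pair i x ∈ S → N.pair i x' ∈ S' → x = x') ?_ ?_
    · intro x _ x' _ hx hx'
      obtain h0 | ⟨j, u, v, h0, -⟩ := h _ hx
      · obtain h1 | ⟨j, u, v, h1, -⟩ := h' _ hx'
        · rw [(pair_inj.1 h0).2, (pair_inj.1 h1).2]
        · exact (Arith.succ_ne_zero _ (pair_inj.1 h1).1.symm).elim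
      · exact (Arith.succ_ne_zero _ (pair_inj.1 h0).1.symm).elim
    · intro i ih x _ x' _ hx hx'
      obtain h0 | ⟨j, u, v, h0, hu, hv⟩ := h _ hx
      · exact (Arith.succ_ne_zero _ (pair_inj.1 h0).1).elim
      obtain h1 | ⟨j', u', v', h1, hu', hv'⟩ := h' _ hx'
      · exact (Arith.succ_ne_zero _ (pair_inj.1 h1).1).elim
      obtain ⟨hj, rfl⟩ := pair_inj.1 h0
      obtain ⟨hj', rfl⟩ := pair_inj.1 h1
      obtain rfl := Arith.succ_inj hj
      obtain rfl := Arith.succ_inj hj'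
      obtain rfl := ih u ((le_pair_right _ _).trans_lt (hb _ hu)) u'
        ((le_pair_right _ _).trans_lt (hb' _ hu')) hu hu'
      exact (hF u).unique hv hv'
  exact key i x ((le_pair_right _ _).trans_lt (hb _ hx)) x'
    ((le_pair_right _ _).trans_lt (hb' _ hx')) hx hx'

theorem exists_iterCode_zero (F : Set N.M) (a : N.M) : ∃ y, IterCode F a (N.pair 0 a) y :=
  exists_iterCode_iff.2 ⟨{z | z = N.pair 0 a}, delta0_comprehension,
    ⟨N.pair 0 a + 1, fun _ hx => hx ▸ lt_add_one_iff.2 le_rfl⟩, fun _ hz => Or.inl hz, rfl⟩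

theorem exists_iterCode_succ {F : Set N.M} {a i u v : N.M} (hv : N.pair u v ∈ F)
    (hu : ∃ y, IterCode F a (N.pair i u) y) : ∃ y, IterCode F a (N.pair (i + 1) v) y := by
  obtain ⟨S, hS, ⟨b, hb⟩, h, hu⟩ := exists_iterCode_iff.1 hu
  have := Fact.mk hS
  refine exists_iterCode_iff.2 ⟨{z | z ∈ S ∨ z = N.pair (i + 1) v}, delta0_comprehension,
    ⟨b + N.pair (i + 1) v + 1, ?_⟩, ?_, Or.inr rfl⟩
  · rintro x (hx | rfl)
    · exact lt_add_one_iff.2 ((hb x hx).le.trans le_self_add)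
    · exact lt_add_one_iff.2 le_add_self
  · rintro x (hx | rfl)
    · refine (h x hx).imp_right ?_
      rintro ⟨j, u, v, h⟩
      exact ⟨j, u, v, h.1, Or.inl h.2.1, h.2.2⟩
    · exact Or.inr ⟨i, u, v, rfl, Or.inl hu, hv⟩

/-- The sequence of iterates `a, F(a), F(F(a)), …` exists. Its graph is `Σ⁰₁` as the set of pairs
that occur in a finite derivation; since the iterates are unique, a pair `⟨i, x⟩` is in the graph if
and only if no derivation contains `⟨i, x'⟩` for an `x' ≠ x`, which is `Π⁰₁`. -/
theorem exists_iterate {F : Set N.M} (hFs : F ∈ N.sets) (hF : ∀ x, ∃! y, N.pair x y ∈ F)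
    (a : N.M) : ∃ H ∈ N.sets, (∀ z ∈ H, ∃ i x, z = N.pair i x) ∧ (∀ i, ∃! x, N.pair i x ∈ H) ∧
      N.pair 0 a ∈ H ∧ ∀ i x y, N.pair i x ∈ H → N.pair x y ∈ F → N.pair (i + 1) y ∈ H := by
  have := Fact.mk hFs
  have hex : ∀ i, ∃ y, ∃ x < y, IterCode F a (N.pair i x) y := by
    refine sigma1_induction (P := fun i y => ∃ x < y, IterCode F a (N.pair i x) y) ?_ ?_
    · obtain ⟨y, hy⟩ := exists_iterCode_zero F a
      exact ⟨a + 1 + y, a, lt_of_lt_of_le (lt_add_one_iff.2 le_rfl) le_self_add,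
        hy.mono le_add_self⟩
    · rintro i ⟨y, x, -, hx⟩
      obtain ⟨v, hv, -⟩ := hF x
      obtain ⟨y', hy'⟩ := exists_iterCode_succ hv ⟨y, hx⟩
      exact ⟨v + 1 + y', v, lt_of_lt_of_le (lt_add_one_iff.2 le_rfl) le_self_add,
        hy'.mono le_add_self⟩
  have huniq : ∀ i x x', (∃ y, IterCode F a (N.pair i x) y) →
      (∃ y, IterCode F a (N.pair i x') y) → x = x' := by
    intro i x x' h h'
    obtain ⟨S, hS, ⟨b, hb⟩, h, hx⟩ := exists_iterCode_iff.1 h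
    obtain ⟨S', hS', ⟨b', hb'⟩, h', hx'⟩ := exists_iterCode_iff.1 h'
    exact h.unique hF hS hS' hb hb' h' hx hx'
  have hpair : ∀ z, (∃ y, IterCode F a z y) → ∃ i x, z = N.pair i x := by
    intro z hz
    obtain ⟨S, hS, -, h, hz⟩ := exists_iterCode_iff.1 hz
    rcases h z hz with rfl | ⟨j, u, v, rfl, -⟩
    exacts [⟨_, _, rfl⟩, ⟨_, _, rfl⟩]
  obtain ⟨H, hH, hmem⟩ := delta1_comprehension (N := N) (P := fun z y => IterCode F a z y)
    (Q := fun z y => (∃ i < z + 1, ∃ x < z + 1, z = N.pair i x) ∧ ∀ i < z + 1, ∀ x < z + 1,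
      z = N.pair i x → ∀ x' < y, IterCode F a (N.pair i x') y → x = x') <| by
    intro z
    constructor
    · intro hz y
      obtain ⟨i, x, rfl⟩ := hpair z hz
      refine ⟨⟨i, lt_add_one_iff.2 (le_pair_left _ _), x, lt_add_one_iff.2 (le_pair_right _ _),
        rfl⟩, fun i' _ x₁ _ h x' _ hx' => ?_⟩
      obtain ⟨rfl, rfl⟩ := pair_inj.1 h
      exact huniq _ _ _ hz ⟨y, hx'⟩
    · intro h
      obtain ⟨i, hi, x, hx, rfl⟩ := (h 0).1
      obtain ⟨y, x', hx'y, hx'⟩ := hex i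
      obtain rfl := (h y).2 i hi x hx rfl x' hx'y hx'
      exact ⟨y, hx'⟩
  refine ⟨H, hH, fun z hz => hpair z ((hmem z).1 hz), fun i => ?_,
    (hmem _).2 (exists_iterCode_zero F a), fun i x y hx hy => ?_⟩
  · obtain ⟨y, x, -, hx⟩ := hex i
    exact ⟨x, (hmem _).2 ⟨y, hx⟩, fun x' hx' => huniq _ _ _ ((hmem _).1 hx') ⟨y, hx⟩⟩
  · exact (hmem _).2 (exists_iterCode_succ hy ((hmem _).1 hx))

/-! ### Enumeration of infinite sets -/

/-- An infinite set has a strictly increasing enumeration. -/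
theorem exists_enumeration {Y : Set N.M} (hY : Y ∈ N.sets) (hinf : N.Infinite Y) :
    ∃ H ∈ N.sets, N.IsBijection H Set.univ Y ∧
      ∀ i j x y, N.pair i x ∈ H → N.pair j y ∈ H → i < j → x < y := by
  have := Fact.mk hY
  obtain ⟨a, haY, ha⟩ := exists_least hY ((hinf 0).imp fun _ h => h.1)
  set F : Set N.M := {z | ∃ x < z + 1, ∃ y < z + 1, z = N.pair x y ∧ y ∈ Y ∧ x < y ∧
    ∀ t < y, x < t → t ∉ Y}
  have hFs : F ∈ N.sets := delta0_comprehension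
  have hFmem : ∀ x y, N.pair x y ∈ F ↔ y ∈ Y ∧ x < y ∧ ∀ t < y, x < t → t ∉ Y := by
    intro x y
    constructor
    · rintro ⟨x', -, y', -, h, h'⟩
      obtain ⟨rfl, rfl⟩ := pair_inj.1 h
      exact h'
    · exact fun h => ⟨x, lt_add_one_iff.2 (le_pair_left _ _), y,
        lt_add_one_iff.2 (le_pair_right _ _), rfl, h⟩
  have hF : ∀ x, ∃! y, N.pair x y ∈ F := by
    intro x
    obtain ⟨y, ⟨hy, hxy⟩, hmin⟩ := exists_least (X := {y | y ∈ Y ∧ x < y})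
      delta0_comprehension (hinf x)
    refine ⟨y, (hFmem x y).2 ⟨hy, hxy, fun t ht hxt htY => ht.not_ge (hmin t ⟨htY, hxt⟩)⟩,
      fun y' hy' => ?_⟩
    obtain ⟨hy', hxy', hmin'⟩ := (hFmem x y').1 hy'
    refine (hmin y' ⟨hy', hxy'⟩).antisymm' (not_lt.1 fun h => hmin' y h hxy hy)
  obtain ⟨H, hH, hpair, hfun, h0, hsucc⟩ := exists_iterate hFs hF a
  have := Fact.mk hH
  have hstep : ∀ i x, N.pair i x ∈ H → ∃ y, N.pair (i + 1) y ∈ H ∧ y ∈ Y ∧ x < y ∧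
      ∀ t < y, x < t → t ∉ Y := by
    intro i x hx
    obtain ⟨y, hy, -⟩ := hF x
    exact ⟨y, hsucc i x y hx hy, (hFmem x y).1 hy⟩
  have hmemY : ∀ i x, N.pair i x ∈ H → x ∈ Y ∧ i ≤ x := by
    intro i x hx
    obtain ⟨x', hx', h⟩ := sigma1_induction (P := fun i x => N.pair i x ∈ H ∧ x ∈ Y ∧ i ≤ x)
      ⟨a, h0, haY, zero_le⟩ (fun i ⟨x, hx, _, hix⟩ => by
        obtain ⟨y, hy, hyY, hxy, -⟩ := hstep i x hx
        exact ⟨y, hy, hyY, not_lt.1 fun h =>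
          (hix.trans_lt hxy).not_ge (lt_add_one_iff.1 h)⟩) i
    rwa [(hfun i).unique hx hx']
  have hmono : ∀ i j x y, N.pair i x ∈ H → N.pair j y ∈ H → i < j → x < y := by
    intro i j x y hx hy hij
    obtain ⟨d, rfl⟩ := Arith.lt_iff.1 hij
    obtain ⟨y', hy', h⟩ := sigma1_induction (P := fun d y => N.pair (i + (d + 1)) y ∈ H ∧ x < y)
      (by
        obtain ⟨y, hy, -, hxy, -⟩ := hstep i x hx
        exact ⟨y, by rwa [zero_add], hxy⟩) (fun d ⟨y, hy, hxy⟩ => by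
        obtain ⟨y', hy', -, hyy', -⟩ := hstep _ y hy
        exact ⟨y', by rwa [← add_assoc], hxy.trans hyy'⟩) d
    rwa [(hfun _).unique hy hy']
  refine ⟨H, hH, ⟨⟨fun z hz => ?_, fun i _ => hfun i⟩, fun y hy => ?_⟩, hmono⟩
  · obtain ⟨i, x, rfl⟩ := hpair z hz
    exact pair_mem_prod.2 ⟨trivial, (hmemY i x hz).1⟩
  · -- Up to stage `y`, either `y` has been enumerated or the values are still below `y`; the
    -- latter fails at stage `y`, as the `i`-th value is at least `i`.
    have key : ∀ i, ∃ x, N.pair i x ∈ H ∧ (x < y ∨ ∃ j < i + 1, N.pair j y ∈ H) := by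
      refine sigma1_induction
        (P := fun i x => N.pair i x ∈ H ∧ (x < y ∨ ∃ j < i + 1, N.pair j y ∈ H)) ?_ ?_
      · refine ⟨a, h0, (ha y hy).lt_or_eq.imp_right ?_⟩
        rintro rfl
        exact ⟨0, lt_add_one_iff.2 le_rfl, h0⟩
      · rintro i ⟨x, hx, h⟩
        obtain ⟨x', hx', -, hxx', hmin⟩ := hstep i x hx
        refine ⟨x', hx', ?_⟩
        rcases h with h | ⟨j, hj, h⟩
        · rcases lt_trichotomy x' y with h' | rfl | h'
          · exact Or.inl h'
          · exact Or.inr ⟨i + 1, lt_add_one_iff.2 le_rfl, hx'⟩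
          · exact (hmin y h' h hy).elim
        · exact Or.inr ⟨j, lt_add_one_iff.2 hj.le, h⟩
    obtain ⟨x, hx, h⟩ := key y
    obtain ⟨j, -, hj⟩ := h.resolve_left ((hmemY y x hx).2).not_gt
    refine ⟨j, ⟨trivial, hj⟩, fun j' ⟨_, hj'⟩ => ?_⟩
    rcases lt_trichotomy j' j with h | h | h
    · exact (lt_irrefl _ (hmono _ _ _ _ hj' hj h)).elim
    · exact h
    · exact (lt_irrefl _ (hmono _ _ _ _ hj hj' h)).elim

/-! ### Homogeneous sets for transitive relations -/

/-- `CAC` gives infinite homogeneous sets for transitive colourings of pairs with two colours, one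
of which need not be transitive. The colouring `T x y` is read with `x` and `y` as the variables
`1` and `0` of a context of four, as it occurs below two quantifiers in an instance of
comprehension. -/
theorem CAC.exists_homogeneous (h : N.CAC) {Y : Set N.M} (hY : Y ∈ N.sets) (hinf : N.Infinite Y)
    {T : N.M → N.M → Prop} [IsDelta0 N 4 (fun w => T (w 1) (w 0))]
    (hT : ∀ x ∈ Y, ∀ y ∈ Y, ∀ z ∈ Y, T x y → T y z → T x z) :
    ∃ Z ∈ N.sets, Z ⊆ Y ∧ N.Infinite Z ∧
      ((∀ x ∈ Z, ∀ y ∈ Z, x < y → T x y) ∨ (∀ x ∈ Z, ∀ y ∈ Z, x < y → ¬ T x y)) := by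
  have := Fact.mk hY
  set R : Set N.M := {z | ∃ x < z + 1, ∃ y < z + 1, z = N.pair x y ∧ x ∈ Y ∧ y ∈ Y ∧
    (x = y ∨ x < y ∧ T x y)}
  have hR : R ∈ N.sets := delta0_comprehension
  have hmem : ∀ x y, N.pair x y ∈ R ↔ x ∈ Y ∧ y ∈ Y ∧ (x = y ∨ x < y ∧ T x y) := by
    intro x y
    constructor
    · rintro ⟨x', -, y', -, h, h'⟩
      obtain ⟨rfl, rfl⟩ := pair_inj.1 h
      exact h'
    · exact fun h => ⟨x, lt_add_one_iff.2 (le_pair_left _ _), y,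
        lt_add_one_iff.2 (le_pair_right _ _), rfl, h⟩
  obtain ⟨Z, hZ, hZY, hZinf, hZR⟩ := h Y hY R hR
    { subset := by
        rintro _ ⟨x, -, y, -, rfl, hx, hy, -⟩
        exact pair_mem_prod.2 ⟨hx, hy⟩
      refl := fun x hx => (hmem x x).2 ⟨hx, hx, Or.inl rfl⟩
      antisymm := fun x _ y _ hxy hyx => by
        rcases ((hmem x y).1 hxy).2.2 with h | h
        · exact h
        · rcases ((hmem y x).1 hyx).2.2 with h' | h'
          · exact h'.symm
          · exact (lt_asymm h.1 h'.1).elim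
      trans := fun x hx y hy z hz hxy hyz => by
        refine (hmem x z).2 ⟨hx, hz, ?_⟩
        rcases ((hmem x y).1 hxy).2.2 with rfl | h
        · exact ((hmem x z).1 hyz).2.2
        · rcases ((hmem y z).1 hyz).2.2 with rfl | h'
          · exact Or.inr h
          · exact Or.inr ⟨h.1.trans h'.1, hT x hx y hy z hz h.2 h'.2⟩ } hinf
  refine ⟨Z, hZ, hZY, hZinf, hZR.imp (fun hc x hx y hy hxy => ?_) fun ha x hx y hy hxy hTxy => ?_⟩
  · rcases hc x hx y hy with h' | h'
    · exact (((hmem x y).1 h').2.2.resolve_left hxy.ne).2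
    · exact (((hmem y x).1 h').2.2.elim (fun h => hxy.ne h.symm) fun h => lt_asymm hxy h.1).elim
  · exact (ha x hx y hy hxy.ne).1 ((hmem x y).2 ⟨hZY hx, hZY hy, Or.inr ⟨hxy, hTxy⟩⟩)

/-! ### Segment topologies -/

theorem initialImage_eq {H Y : Set N.M} (hH : N.IsBijection H Set.univ Y)
    (hmono : ∀ i j x y, N.pair i x ∈ H → N.pair j y ∈ H → i < j → x < y) {j x : N.M}
    (hx : N.pair j x ∈ H) : N.initialImage H j = {y | y ∈ Y ∧ y ≤ x} := by
  ext y
  constructor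
  · rintro ⟨i, hij, hy⟩
    refine ⟨(pair_mem_prod.1 (hH.1.1 hy)).2, ?_⟩
    rcases hij with hij | rfl
    · exact (hmono _ _ _ _ hy hx hij).le
    · exact ((hH.1.2 i trivial).unique hy hx).le
  · rintro ⟨hy, hyx⟩
    obtain ⟨i, ⟨-, hi⟩, -⟩ := hH.2 y hy
    exact ⟨i, not_lt.1 fun h => (hmono _ _ _ _ hx hi h).not_ge hyx, hi⟩

theorem finalImage_eq {H Y : Set N.M} (hH : N.IsBijection H Set.univ Y)
    (hmono : ∀ i j x y, N.pair i x ∈ H → N.pair j y ∈ H → i < j → x < y) {j x : N.M}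
    (hx : N.pair j x ∈ H) : N.finalImage H j = {y | y ∈ Y ∧ x ≤ y} := by
  ext y
  constructor
  · rintro ⟨i, hij, hy⟩
    refine ⟨(pair_mem_prod.1 (hH.1.1 hy)).2, ?_⟩
    rcases hij with hij | rfl
    · exact (hmono _ _ _ _ hx hy hij).le
    · exact ((hH.1.2 j trivial).unique hy hx).ge
  · rintro ⟨hy, hyx⟩
    obtain ⟨i, ⟨-, hi⟩, -⟩ := hH.2 y hy
    exact ⟨i, not_lt.1 fun h => (hmono _ _ _ _ hi hx h).not_ge hyx, hi⟩

theorem subspaceBasis_mem_sets {U Y : Set N.M} (hU : U ∈ N.sets) (hY : Y ∈ N.sets) (n : N.M) :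
    N.subspaceBasis U Y n ∈ N.sets := by
  have := Fact.mk hU
  have := Fact.mk hY
  exact delta0_comprehension (P := fun x => N.pair n x ∈ U ∧ x ∈ Y)

theorem hasFinalSegmentTopology {U Y : Set N.M} (hU : U ∈ N.sets) (hY : Y ∈ N.sets)
    (hinf : N.Infinite Y) (hcover : ∀ x ∈ Y, ∃ n, x ∈ N.member U n)
    (hup : ∀ x ∈ Y, ∀ y ∈ Y, x < y → ∀ n, x ∈ N.member U n → y ∈ N.member U n)
    (hsep : ∀ x ∈ Y, ∀ y ∈ Y, x < y → ∃ n, y ∈ N.member U n ∧ x ∉ N.member U n) :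
    N.HasFinalSegmentTopology Y (N.subspaceBasis U Y) := by
  have := Fact.mk hY
  obtain ⟨H, hH, hbij, hmono⟩ := exists_enumeration hY hinf
  have hup' : ∀ n, ∀ x ∈ N.subspaceBasis U Y n, ∀ y ∈ Y, x ≤ y → y ∈ N.subspaceBasis U Y n := by
    rintro n x ⟨hx, hxY⟩ y hy hxy
    rcases hxy.lt_or_eq with h | rfl
    exacts [⟨hup x hxY y hy h n hx, hy⟩, ⟨hx, hy⟩]
  refine ⟨H, hH, hbij, fun n => ?_, fun j => ?_⟩
  · rcases (N.subspaceBasis U Y n).eq_empty_or_nonempty with h | h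
    · exact Or.inl h
    obtain ⟨x, hx, hmin⟩ := exists_least (subspaceBasis_mem_sets hU hY n) h
    obtain ⟨j, ⟨-, hj⟩, -⟩ := hbij.2 x hx.2
    refine Or.inr (Or.inr ⟨j, ?_⟩)
    rw [finalImage_eq hbij hmono hj]
    exact Set.ext fun y => ⟨fun hy => ⟨hy.2, hmin y hy⟩, fun hy => hup' n x hx y hy.1 hy.2⟩
  · obtain ⟨x, hj, -⟩ := hbij.1.2 j trivial
    have hx : x ∈ Y := (pair_mem_prod.1 (hbij.1.1 hj)).2
    rw [finalImage_eq hbij hmono hj]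
    suffices ∃ n, x ∈ N.member U n ∧ ∀ y ∈ Y, y < x → y ∉ N.member U n by
      obtain ⟨n, hxn, hn⟩ := this
      exact ⟨n, Set.ext fun y => ⟨fun hy => ⟨hy.2, not_lt.1 fun h => hn y hy.2 h hy.1⟩,
        fun hy => hup' n x ⟨hxn, hx⟩ y hy.1 hy.2⟩⟩
    -- A basic open set that separates `x` from its predecessor in `Y` has least element `x`.
    rcases {y | y ∈ Y ∧ y < x}.eq_empty_or_nonempty with h | h
    · obtain ⟨n, hn⟩ := hcover x hx
      exact ⟨n, hn, fun y hy hyx => (h.subset ⟨hy, hyx⟩ : y ∈ (∅ : Set N.M)).elim⟩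
    · obtain ⟨z, ⟨hz, hzx⟩, hmax⟩ := exists_greatest delta0_comprehension h (c := x)
        fun y hy => hy.2.le
      obtain ⟨n, hxn, hzn⟩ := hsep z hz x hx hzx
      exact ⟨n, hxn, fun y hy hyx hyn =>
        hzn (hup' n y ⟨hyn, hy⟩ z hz (hmax y ⟨hy, hyx⟩)).1⟩

theorem hasInitialSegmentTopology {U Y : Set N.M} (hU : U ∈ N.sets) (hY : Y ∈ N.sets)
    (hinf : N.Infinite Y)
    (hdown : ∀ x ∈ Y, ∀ y ∈ Y, x < y → ∀ n, y ∈ N.member U n → x ∈ N.member U n)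
    (hsep : ∀ x ∈ Y, ∀ y ∈ Y, x < y → ∃ n, x ∈ N.member U n ∧ y ∉ N.member U n) :
    N.HasInitialSegmentTopology Y (N.subspaceBasis U Y) := by
  have := Fact.mk hY
  obtain ⟨H, hH, hbij, hmono⟩ := exists_enumeration hY hinf
  have hdown' : ∀ n, ∀ x ∈ N.subspaceBasis U Y n, ∀ y ∈ Y, y ≤ x →
      y ∈ N.subspaceBasis U Y n := by
    rintro n x ⟨hx, hxY⟩ y hy hxy
    rcases hxy.lt_or_eq with h | rfl
    exacts [⟨hdown y hy x hxY h n hx, hy⟩, ⟨hx, hy⟩]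
  refine ⟨H, hH, hbij, fun n => ?_, fun j => ?_⟩
  · rcases (N.subspaceBasis U Y n).eq_empty_or_nonempty with h | h
    · exact Or.inl h
    refine Or.inr ?_
    by_cases hall : ∀ y ∈ Y, y ∈ N.subspaceBasis U Y n
    · exact Or.inl (Set.Subset.antisymm (fun y hy => hy.2) hall)
    push Not at hall
    obtain ⟨c, hc, hcn⟩ := hall
    obtain ⟨x, hx, hmax⟩ := exists_greatest (subspaceBasis_mem_sets hU hY n) h (c := c)
      fun y hy => not_lt.1 fun h => hcn (hdown' n y hy c hc h.le)
    obtain ⟨j, ⟨-, hj⟩, -⟩ := hbij.2 x hx.2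
    refine Or.inr ⟨j, ?_⟩
    rw [initialImage_eq hbij hmono hj]
    exact Set.ext fun y => ⟨fun hy => ⟨hy.2, hmax y hy⟩, fun hy => hdown' n x hx y hy.1 hy.2⟩
  · obtain ⟨x, hj, -⟩ := hbij.1.2 j trivial
    have hx : x ∈ Y := (pair_mem_prod.1 (hbij.1.1 hj)).2
    rw [initialImage_eq hbij hmono hj]
    -- A basic open set that separates `x` from its successor in `Y` has greatest element `x`.
    obtain ⟨z, ⟨hz, hxz⟩, hmin⟩ := exists_least (X := {y | y ∈ Y ∧ x < y})
      delta0_comprehension (hinf x)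
    obtain ⟨n, hxn, hzn⟩ := hsep x hx z hz hxz
    refine ⟨n, Set.ext fun y => ⟨fun hy => ⟨hy.2, not_lt.1 fun h => ?_⟩,
      fun hy => hdown' n x ⟨hxn, hx⟩ y hy.1 hy.2⟩⟩
    exact hzn (hdown' n y hy z hz (hmin y ⟨hy.2, h⟩)).1

/-! ### From `CAC` to `wGS^cl` -/

theorem CAC.wgscl (h : N.CAC) : N.WGScl := by
  rintro X U k hsp hinf ⟨C, hCs, -, hC⟩
  have := Fact.mk hCs
  have hU := hsp.U_mem
  have htrans : ∀ x ∈ X, ∀ y ∈ X, ∀ z ∈ X, N.pair x y ∈ C → N.pair y z ∈ C → N.pair x z ∈ C := by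
    intro x hx y hy z hz hxy hyz
    rw [hC x hx y hy] at hxy
    rw [hC y hy z hz] at hyz
    exact (hC x hx z hz).2 fun n hn => hyz n (hxy n hn)
  have hsep : ∀ x ∈ X, ∀ y ∈ X, N.pair x y ∉ C → ∃ n, x ∈ N.member U n ∧ y ∉ N.member U n := by
    intro x hx y hy hxy
    simpa [hC x hx y hy] using hxy
  -- Either the enumeration of `Y₁` is strictly ascending in the specialization order, or no pair of
  -- elements of `Y₁` is strictly ascending; likewise for descending pairs and `Y₂`.
  obtain ⟨Y₁, hY₁, hY₁X, hinf₁, hasc | hasc⟩ := h.exists_homogeneous hsp.X_mem hinf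
    (T := fun x y => N.pair x y ∈ C ∧ N.pair y x ∉ C) fun x hx y hy z hz hxy hyz =>
      ⟨htrans x hx y hy z hz hxy.1 hyz.1, fun hzx => hxy.2 (htrans y hy z hz x hx hyz.1 hzx)⟩
  · refine ⟨Y₁, hY₁, hY₁X, hinf₁, Or.inr (Or.inr (Or.inl ?_))⟩
    exact hasFinalSegmentTopology hU hY₁ hinf₁ (fun x hx => hsp.cover x (hY₁X hx))
      (fun x hx y hy hxy => (hC x (hY₁X hx) y (hY₁X hy)).1 (hasc x hx y hy hxy).1)
      fun x hx y hy hxy => hsep y (hY₁X hy) x (hY₁X hx) (hasc x hx y hy hxy).2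
  obtain ⟨Y₂, hY₂, hY₂Y, hinf₂, hdesc | hdesc⟩ := h.exists_homogeneous hY₁ hinf₁
    (T := fun x y => N.pair y x ∈ C ∧ N.pair x y ∉ C) fun x hx y hy z hz hxy hyz =>
      ⟨htrans z (hY₁X hz) y (hY₁X hy) x (hY₁X hx) hyz.1 hxy.1,
        fun hxz => hyz.2 (htrans y (hY₁X hy) x (hY₁X hx) z (hY₁X hz) hxy.1 hxz)⟩
  · have hX := hY₂Y.trans hY₁X
    refine ⟨Y₂, hY₂, hX, hinf₂, Or.inr (Or.inl ?_)⟩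
    exact hasInitialSegmentTopology hU hY₂ hinf₂
      (fun x hx y hy hxy => (hC y (hX hy) x (hX hx)).1 (hdesc x hx y hy hxy).1)
      fun x hx y hy hxy => hsep x (hX hx) y (hX hy) (hdesc x hx y hy hxy).2
  -- Any two points that are left are equivalent or incomparable.
  obtain ⟨Y₃, hY₃, hY₃Y, hinf₃, heqv⟩ := h.exists_homogeneous hY₂ hinf₂
    (T := fun x y => N.pair x y ∈ C ∧ N.pair y x ∈ C) fun x hx y hy z hz hxy hyz => by
      have hx := hY₁X (hY₂Y hx)
      have hy := hY₁X (hY₂Y hy)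
      have hz := hY₁X (hY₂Y hz)
      exact ⟨htrans x hx y hy z hz hxy.1 hyz.1, htrans z hz y hy x hx hyz.2 hxy.2⟩
  have hX := hY₃Y.trans (hY₂Y.trans hY₁X)
  refine ⟨Y₃, hY₃, hX, hinf₃, ?_⟩
  rcases heqv with heqv | heqv
  · refine Or.inl fun n => (N.subspaceBasis U Y₃ n).eq_empty_or_nonempty.imp_right ?_
    rintro ⟨x, hx, hxY⟩
    refine Set.Subset.antisymm (fun y hy => hy.2) fun y hy => ⟨?_, hy⟩
    rcases lt_trichotomy x y with hxy | rfl | hxy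
    · exact (hC x (hX hxY) y (hX hy)).1 (heqv x hxY y hy hxy).1 n hx
    · exact hx
    · exact (hC x (hX hxY) y (hX hy)).1 (heqv y hy x hxY hxy).2 n hx
  · have hinc : ∀ x ∈ Y₃, ∀ y ∈ Y₃, x < y → N.pair x y ∉ C ∧ N.pair y x ∉ C := by
      intro x hx y hy hxy
      have h1 := hasc x (hY₂Y (hY₃Y hx)) y (hY₂Y (hY₃Y hy)) hxy
      have h2 := hdesc x (hY₃Y hx) y (hY₃Y hy) hxy
      have h3 := heqv x hx y hy hxy
      tauto
    have hne : ∀ x ∈ Y₃, ∀ y ∈ Y₃, x ≠ y → N.pair x y ∉ C := by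
      intro x hx y hy hxy
      rcases lt_or_gt_of_ne hxy with h | h
      exacts [(hinc x hx y hy h).1, (hinc y hy x hx h).2]
    refine Or.inr (Or.inr (Or.inr fun x hx y hy hxy => ?_))
    obtain ⟨m, hxm, hym⟩ := hsep x (hX hx) y (hX hy) (hne x hx y hy hxy)
    obtain ⟨n, hyn, hxn⟩ := hsep y (hX hy) x (hX hx) (hne y hy x hx hxy.symm)
    exact ⟨m, n, ⟨⟨hxm, hx⟩, fun h => hxn h.1⟩, ⟨hyn, hy⟩, fun h => hym h.1⟩

/-! ### From `wGS^cl` to `CAC` -/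

/-- The cones `{y | x ≤ y}` of a partial order on `P` are the basis of a space; its code is the
order relation `R` itself, and `k (x, m, n) = x`. -/
theorem IsPartialOrder.exists_isCSCSpace {P R : Set N.M} (hP : P ∈ N.sets) (hR : R ∈ N.sets)
    (h : N.IsPartialOrder P R) : ∃ k, N.IsCSCSpace P R k := by
  have := Fact.mk hP
  have := Fact.mk hR
  have hmem : ∀ {x y}, N.pair x y ∈ R → x ∈ P ∧ y ∈ P := fun h' => pair_mem_prod.1 (h.subset h')
  set k : Set N.M := {z | ∃ x < z + 1, ∃ m < z + 1, ∃ n < z + 1,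
    z = N.pair (N.pair (N.pair x m) n) x ∧ x ∈ P}
  have hkmem : ∀ {x m n j}, N.pair (N.pair (N.pair x m) n) j ∈ k ↔ x ∈ P ∧ j = x := by
    intro x m n j
    constructor
    · rintro ⟨x', -, m', -, n', -, h, hx⟩
      obtain ⟨h, rfl⟩ := pair_inj.1 h
      obtain ⟨rfl, -⟩ := pair_inj.1 (pair_inj.1 h).1
      exact ⟨hx, rfl⟩
    · rintro ⟨hx, rfl⟩
      exact ⟨j, lt_add_one_iff.2 (le_pair_right _ _),
        m, lt_add_one_iff.2 ((le_pair_right _ _).trans <| (le_pair_left _ _).trans <|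
          le_pair_left _ _),
        n, lt_add_one_iff.2 ((le_pair_right _ _).trans <| le_pair_left _ _), rfl, hx⟩
  refine ⟨k, hP, hR, delta0_comprehension, fun n x hx => (hmem hx).2,
    fun x hx => ⟨x, h.refl x hx⟩, ⟨?_, ?_⟩, ?_⟩
  · rintro _ ⟨x, -, m, -, n, -, rfl, hx⟩
    exact pair_mem_prod.2
      ⟨pair_mem_prod.2 ⟨pair_mem_prod.2 ⟨hx, trivial⟩, trivial⟩, trivial⟩
  · rintro _ ⟨_, ⟨x, hx, m, -, rfl⟩, n, -, rfl⟩
    exact ⟨x, hkmem.2 ⟨hx, rfl⟩, fun j hj => (hkmem.1 hj).2⟩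
  · rintro x hx m n ⟨hm, hn⟩ j hj
    obtain ⟨-, rfl⟩ := hkmem.1 hj
    exact ⟨h.refl j hx, fun y hy =>
      ⟨h.trans n (hmem hn).1 j hx y (hmem hy).2 hn hy,
        h.trans m (hmem hm).1 j hx y (hmem hy).2 hm hy⟩⟩

theorem WGScl.cac (h : N.WGScl) : N.CAC := by
  intro P hP R hR hpo hinf
  have hmem : ∀ {x y}, N.pair x y ∈ R → x ∈ P ∧ y ∈ P := fun h' => pair_mem_prod.1 (hpo.subset h')
  obtain ⟨k, hk⟩ := hpo.exists_isCSCSpace hP hR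
  have htrans : ∀ {x y z}, N.pair x y ∈ R → N.pair y z ∈ R → N.pair x z ∈ R := fun hxy hyz =>
    hpo.trans _ (hmem hxy).1 _ (hmem hxy).2 _ (hmem hyz).2 hxy hyz
  obtain ⟨Y, hY, hYP, hYinf, htop⟩ := h P R k hk hinf ⟨R, hR, hpo.subset, fun y hy x _ =>
    ⟨fun hyx n hn => htrans hn hyx, fun h => h y (hpo.refl y hy)⟩⟩
  refine ⟨Y, hY, hYP, hYinf, ?_⟩
  have hself : ∀ x ∈ Y, x ∈ N.subspaceBasis R Y x := fun x hx => ⟨hpo.refl x (hYP hx), hx⟩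
  have hchain : (∀ x ∈ Y, ∀ y ∈ Y, N.subspaceBasis R Y x ⊆ N.subspaceBasis R Y y ∨
      N.subspaceBasis R Y y ⊆ N.subspaceBasis R Y x) → N.IsChain R Y := by
    intro h x hx y hy
    exact (h x hx y hy).symm.imp (fun h => (h (hself y hy)).1) fun h => (h (hself x hx)).1
  have hseg : ∀ S : N.M → Set N.M, (∀ i j, S i ⊆ S j ∨ S j ⊆ S i) →
      (∀ n, N.subspaceBasis R Y n = ∅ ∨ N.subspaceBasis R Y n = Y ∨
        ∃ j, N.subspaceBasis R Y n = S j) → N.IsChain R Y := by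
    intro S hS hW
    refine hchain fun x _ y _ => ?_
    have hsub : ∀ n, N.subspaceBasis R Y n ⊆ Y := fun n z hz => hz.2
    rcases hW x with hx | hx | ⟨i, hx⟩
    · exact Or.inl (hx ▸ Set.empty_subset _)
    · exact Or.inr ((hsub y).trans hx.ge)
    rcases hW y with hy | hy | ⟨j, hy⟩
    · exact Or.inr (hy ▸ Set.empty_subset _)
    · exact Or.inl ((hsub x).trans hy.ge)
    rw [hx, hy]
    exact hS i j
  rcases htop with h | ⟨H, -, -, hW, -⟩ | ⟨H, -, -, hW, -⟩ | h
  · refine Or.inl (hseg (fun _ => Y) (fun _ _ => Or.inl subset_rfl) fun n => ?_)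
    exact (h n).imp_right Or.inl
  · refine Or.inl (hseg _ (fun i j => ?_) hW)
    refine (le_total i j).imp ?_ ?_ <;> exact fun hij x ⟨l, hl, hx⟩ => ⟨l, le_trans hl hij, hx⟩
  · refine Or.inl (hseg _ (fun i j => ?_) hW)
    refine (le_total j i).imp ?_ ?_ <;> exact fun hij x ⟨l, hl, hx⟩ => ⟨l, le_trans hij hl, hx⟩
  · have hne : ∀ x ∈ Y, ∀ y ∈ Y, x ≠ y → N.pair x y ∉ R := by
      intro x hx y hy hxy hR
      obtain ⟨m, n, hm, hn⟩ := h x hx y hy hxy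
      exact hn.2 ⟨htrans hm.1.1 hR, hy⟩
    exact Or.inr fun x hx y hy hxy => ⟨hne x hx y hy hxy, hne y hy x hx hxy.symm⟩

end L2Structure

theorem mainTheorem3 :
    ∀ N : L2Structure.{u}, N.IsModelRCA0 → (N.CAC ↔ N.WGScl) := by
  intro N hN
  have := Fact.mk hN
  exact ⟨L2Structure.CAC.wgscl, L2Structure.WGScl.cac⟩
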